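/- Let $N\ge 1$, let $A\subseteq\mathbb{R}^N$ be open, let $T>0$, and let $u_0\in L^2(A;\mathbb{R}^N)$ be such that its distributional divergence is a function $\operatorname{div}u_0=g\in L^p(A)$ for some $p>1$. For $u\in L^2(A;\mathbb{R}^N)$ set $$\mathcal{D}(u)=\sup\Big\{-\int_A u\cdot\nabla\varphi\,dx:\ \varphi\in C_c^\infty(A),\ |\varphi|\le 1\Big\}\in[0,+\infty],$$ i.e. $\mathcal{D}(u)=\int_A|\operatorname{div}u|$, and let $\partial\mathcal{D}$ be its subdifferential in $L^2(A;\mathbb{R}^N)$. A triple $(E^+,E^-,v)$ is called a *monotone weak Hele-Shaw solution* if the following hold. 1. $E^\pm\subseteq[0,T]\times A$ are measurable, $v\in L^1([0,T);H^1_0(A))$, $|v|\le 1$ a.e., and $v=\pm1$ a.e. on $E^\pm$. 2. With $E(t)=E^+(t)\cup E^-(t)$, $E^\pm(t)=\{x:(t,x)\in E^\pm\}$, for every $\varphi\in C_c^\infty([0,T)\times A)$, $$\int_A g\,\varphi(0,x)\,dx+\int_0^T\!\!\int_A g\,\chi_{E(t)}\,\partial_t\varphi\,dx\,dt-\int_0^T\!\!\int_A\nabla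 v\cdot\nabla\varphi\,dx\,dt=0 .$$ 3. $\pm g\ge 0$ a.e. on $E^\pm$. 4. For almost all $s<t$ in $(0,T)$, $E^\pm(t)\subseteq E^\pm(s)$ up to Lebesgue-null sets. Let $(E^+,E^-,v)$ be a monotone weak Hele-Shaw solution and put $u(t)=u_0+\nabla\int_0^t v(s)\,ds$. Then: (a) The pair $(u,v)$ solves $$u_t=\nabla v,\qquad u(0)=u_0,\qquad |v|\le 1,\quad \mathcal{D}(u(t))+\int_A u(t)\cdot\nabla v(t)\,dx=0\quad\text{for a.e. }t\in(0,T),$$ and it is the unique solution: any pair $(u_1,v_1)$ solving this problem on $[0,T)$, with $v_1(t)\in H^1_0(A)$ and $u_1:[0,T)\to L^2(A;\mathbb{R}^N)$ continuous and locally absolutely continuous on $(0,T)$, satisfies $u_1=u$ on $[0,T)$ and $v_1(t)=v(t)$ for a.e. $t\in(0,T)$. (b) $u$ is the unique solution of the gradient flow of $\mathcal{D}$ from $u_0$, that is, the unique continuous $u:[0,T)\to L^2(A;\mathbb{R}^N)$, locally absolutely continuous on $(0,T)$, with $u(0)=u_0$ and $-u_t(t)\in\partial\mathcal{D}(u(t))$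 for a.e. $t\in(0,T)$. (c) In particular the monotone weak Hele-Shaw solution is unique: if $(E_1^+,E_1^-,v_1)$ is another one (same $u_0$ and $T$), then $v_1(t)=v(t)$ for a.e. $t\in(0,T)$, and $E_1^\pm$ and $E^\pm$ coincide up to a null set in $(0,T)\times\{g\ne0\}$. -/

import Mathlib

open MeasureTheory Set
open scoped ContDiff

noncomputable section

namespace HeleShaw

/-- The Euclidean space `ℝ^N`. -/
abbrev Sp (N : ℕ) := EuclideanSpace ℝ (Fin N)

/-- The scalar space `L²(A)`. -/
abbrev L2 {N : ℕ} (A : Set (Sp N)) := Lp ℝ 2 (volume.restrict A)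

/-- The space of vector fields `L²(A; ℝ^N)`. -/
abbrev L2Vec {N : ℕ} (A : Set (Sp N)) := Lp (Sp N) 2 (volume.restrict A)

/-- `φ ∈ C_c^∞(A)`. -/
structure IsTest {N : ℕ} (A : Set (Sp N)) (φ : Sp N → ℝ) : Prop where
  smooth : ContDiff ℝ ∞ φ
  compact : HasCompactSupport φ
  supp : tsupport φ ⊆ A

theorem IsTest.differentiableAt {N : ℕ} {A : Set (Sp N)} {φ : Sp N → ℝ} (h : IsTest A φ)
    (x : Sp N) : DifferentiableAt ℝ φ x :=
  (h.smooth.differentiable (by simp)) x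

/-- The pairs `(φ, ∇φ)`, `φ ∈ C_c^∞(A)`, as a subspace of `L²(A) × L²(A; ℝ^N)`. -/
def testGraph {N : ℕ} (A : Set (Sp N)) : Submodule ℝ (L2 A × L2Vec A) where
  carrier := {q | ∃ φ : Sp N → ℝ, IsTest A φ ∧ q.1 =ᵐ[volume.restrict A] φ ∧
    q.2 =ᵐ[volume.restrict A] gradient φ}
  zero_mem' := by
    refine ⟨fun _ => 0, ⟨contDiff_const, HasCompactSupport.zero, ?_⟩, ?_, ?_⟩
    · simp [tsupport]
    · exact Lp.coeFn_zero _ _ _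
    · have h0 : gradient (fun _ : Sp N => (0 : ℝ)) = 0 := by
        ext1 x; simp [gradient_fun_const]
      rw [h0]; exact Lp.coeFn_zero _ _ _
  add_mem' := by
    rintro a b ⟨φ, hφ, h1, h2⟩ ⟨ψ, hψ, h3, h4⟩
    refine ⟨φ + ψ, ⟨hφ.smooth.add hψ.smooth, hφ.compact.add hψ.compact, ?_⟩, ?_, ?_⟩
    · exact (tsupport_add φ ψ).trans (union_subset hφ.supp hψ.supp)
    · exact (Lp.coeFn_add _ _).trans (h1.add h3)
    · have h0 : gradient (φ + ψ) = gradient φ + gradient ψ := by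
        ext1 x
        simp only [gradient, Pi.add_apply]
        rw [fderiv_add (hφ.differentiableAt x) (hψ.differentiableAt x), map_add]
      rw [h0]; exact (Lp.coeFn_add _ _).trans (h2.add h4)
  smul_mem' := by
    rintro c a ⟨φ, hφ, h1, h2⟩
    refine ⟨c • φ, ⟨hφ.smooth.const_smul c, ?_, ?_⟩, ?_, ?_⟩
    · exact hφ.compact.smul_left (f := fun _ => c)
    · exact (tsupport_smul_subset_right (fun _ => c) φ).trans hφ.supp
    · exact (Lp.coeFn_smul _ _).trans (h1.const_smul c)
    · have h0 : gradient (c • φ) = c • gradient φ := by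
        ext1 x
        simp only [gradient, Pi.smul_apply]
        rw [fderiv_const_smul (hφ.differentiableAt x)]
        simp
      rw [h0]; exact (Lp.coeFn_smul _ _).trans (h2.const_smul c)

/-- `H^1_0(A)`: the closure of `C_c^∞(A)` for the `H^1` norm. An element is the pair formed by
the function and its (weak) gradient; the norm is the maximum of the two `L²` norms, which is
equivalent to the usual `H^1` norm. -/
def H10 {N : ℕ} (A : Set (Sp N)) : Submodule ℝ (L2 A × L2Vec A) :=
  (testGraph A).topologicalClosure

instance {N : ℕ} (A : Set (Sp N)) : CompleteSpace (H10 A) :=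
  (testGraph A).isClosed_topologicalClosure.completeSpace_coe

/-- The underlying `L²` function of an element of `H^1_0(A)`. -/
def H10.fn {N : ℕ} {A : Set (Sp N)} (v : H10 A) : L2 A := v.1.1

/-- The gradient of an element of `H^1_0(A)`. -/
def H10.grad {N : ℕ} {A : Set (Sp N)} (v : H10 A) : L2Vec A := v.1.2

/-- `div u = g` in the sense of distributions on `A`. -/
def HasDiv {N : ℕ} (A : Set (Sp N)) (u : L2Vec A) (g : Sp N → ℝ) : Prop :=
  ∀ φ : Sp N → ℝ, IsTest A φ →
    ∫ x in A, inner ℝ (u x) (gradient φ x) = - ∫ x in A, g x * φ x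

/-- The functional `𝒟(u) = ∫_A |div u| = sup {∫_A -u·∇φ : φ ∈ C_c^∞(A), |φ| ≤ 1} ∈ [0, +∞]`. -/
def totalDiv {N : ℕ} (A : Set (Sp N)) (u : L2Vec A) : EReal :=
  ⨆ (φ : Sp N → ℝ) (_ : IsTest A φ ∧ ∀ x, |φ x| ≤ 1),
    ((∫ x in A, - inner ℝ (u x) (gradient φ x) : ℝ) : EReal)

/-- The subdifferential of `𝒟` at `u` in the Hilbert space `L²(A; ℝ^N)`. -/
def subdiff {N : ℕ} (A : Set (Sp N)) (u : L2Vec A) : Set (L2Vec A) :=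
  {q | ∀ z : L2Vec A, totalDiv A u + ((inner ℝ q (z - u) : ℝ) : EReal) ≤ totalDiv A z}

/-- `u` is a (strong) solution on `[0,T)` of the gradient flow `u_t ∈ -∂𝒟(u)`, `u(0) = u₀`:
it is continuous on `[0,T)` with values in `L²(A; ℝ^N)`, locally absolutely continuous on
`(0,T)` with derivative `u'`, and satisfies the inclusion for almost every time. -/
structure IsGradientFlow {N : ℕ} (A : Set (Sp N)) (T : ℝ) (u₀ : L2Vec A)
    (u : ℝ → L2Vec A) : Prop where
  cont : ContinuousOn u (Ico 0 T)
  init : u 0 = u₀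
  flow : ∃ u' : ℝ → L2Vec A,
    (∀ s t, 0 < s → s < t → t < T →
      IntervalIntegrable u' volume s t ∧ u t - u s = ∫ r in s..t, u' r) ∧
    ∀ᵐ t ∂(volume.restrict (Ioo 0 T)), - u' t ∈ subdiff A (u t)

/-- `(u, v)` is a solution on `[0,T)` of `u_t = ∇v`, `u(0) = u₀`, where for a.e. time
`v(t) ∈ H^1_0(A)`, `|v| ≤ 1` and `𝒟(u) + ∫_A u·∇v = 0`. -/
structure IsDivFlow {N : ℕ} (A : Set (Sp N)) (T : ℝ) (u₀ : L2Vec A)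
    (u : ℝ → L2Vec A) (v : ℝ → H10 A) : Prop where
  cont : ContinuousOn u (Ico 0 T)
  init : u 0 = u₀
  evol : ∀ s t, 0 < s → s < t → t < T →
    IntervalIntegrable (fun r => H10.grad (v r)) volume s t ∧ u t - u s = ∫ r in s..t, H10.grad (v r)
  bound : ∀ᵐ t ∂(volume.restrict (Ioo 0 T)), ∀ᵐ x ∂(volume.restrict A), |H10.fn (v t) x| ≤ 1
  extremal : ∀ᵐ t ∂(volume.restrict (Ioo 0 T)),
    totalDiv A (u t) + ((∫ x in A, inner ℝ (u t x) (H10.grad (v t) x) : ℝ) : EReal) = 0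

/-- `φ ∈ C_c^∞([0,T) × A)`, as the restriction to nonnegative times of an element of
`C_c^∞((-∞,T) × A)`. -/
structure IsSpaceTimeTest {N : ℕ} (A : Set (Sp N)) (T : ℝ) (φ : ℝ × Sp N → ℝ) : Prop where
  smooth : ContDiff ℝ ∞ φ
  compact : HasCompactSupport φ
  supp : tsupport φ ⊆ Iio T ×ˢ A

/-- `(E⁺, E⁻, v)` is a weak solution of the Hele-Shaw flow with `div u₀ = g` on `[0,T) × A`. -/
structure IsWeakHeleShaw {N : ℕ} (A : Set (Sp N)) (T : ℝ) (g : Sp N → ℝ)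
    (Ep Em : Set (ℝ × Sp N)) (v : ℝ → H10 A) : Prop where
  subset_pos : Ep ⊆ Icc 0 T ×ˢ A
  subset_neg : Em ⊆ Icc 0 T ×ˢ A
  measurable_pos : NullMeasurableSet Ep volume
  measurable_neg : NullMeasurableSet Em volume
  integrable : IntegrableOn v (Ico 0 T) volume
  bound : ∀ᵐ t ∂(volume.restrict (Ioo 0 T)), ∀ᵐ x ∂(volume.restrict A), |H10.fn (v t) x| ≤ 1
  eq_pos : ∀ᵐ t ∂(volume.restrict (Ioo 0 T)), ∀ᵐ x ∂(volume.restrict A),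
    (t, x) ∈ Ep → H10.fn (v t) x = 1
  eq_neg : ∀ᵐ t ∂(volume.restrict (Ioo 0 T)), ∀ᵐ x ∂(volume.restrict A),
    (t, x) ∈ Em → H10.fn (v t) x = -1
  weak : ∀ φ : ℝ × Sp N → ℝ, IsSpaceTimeTest A T φ →
    (∫ x in A, g x * φ (0, x))
      + (∫ t in Ioo 0 T, ∫ x in A,
          g x * (Ep ∪ Em).indicator (fun _ => (1 : ℝ)) (t, x) * deriv (fun s => φ (s, x)) t)
      - (∫ t in Ioo 0 T, ∫ x in A,
          inner ℝ (H10.grad (v t) x) (gradient (fun y => φ (t, y)) x)) = 0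

/-- `g ≥ 0` a.e. on `E⁺` and `g ≤ 0` a.e. on `E⁻`. -/
def SignCondition {N : ℕ} (A : Set (Sp N)) (T : ℝ) (g : Sp N → ℝ)
    (Ep Em : Set (ℝ × Sp N)) : Prop :=
  ∀ᵐ t ∂(volume.restrict (Ioo 0 T)), ∀ᵐ x ∂(volume.restrict A),
    ((t, x) ∈ Ep → 0 ≤ g x) ∧ ((t, x) ∈ Em → g x ≤ 0)

/-- `E(t) ⊆ E(s)`, up to a null set, for almost all times `s < t`. -/
def Nonincreasing {N : ℕ} (A : Set (Sp N)) (T : ℝ) (E : Set (ℝ × Sp N)) : Prop :=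
  ∀ᵐ s ∂(volume.restrict (Ioo 0 T)), ∀ᵐ t ∂(volume.restrict (Ioo s T)),
    ∀ᵐ x ∂(volume.restrict A), (t, x) ∈ E → (s, x) ∈ E

end HeleShaw

end

namespace HeleShaw
open Filter Topology

/-! Integrating the weak equation in time shows that `div u(t) = f(t)`, with `f(t) = g χ_{E(t)}`,
for a.e. `t`. Since `v = ±1` on `E^±` and `±g ≥ 0` there, `f v = |f|`: the function `v(t)` is a
bounded `H^1_0` competitor that attains the supremum defining `𝒟(u(t))`.

Attainment is a sandwich. Bounded elements of `H^1_0` can be approximated by bounded test functions,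
so `-∫ z·∇v ≤ 𝒟(z)` for every field `z` (`neg_integral_inner_grad_le_totalDiv`). Conversely, a
Brezis–Browder argument with spatial cut-offs gives `∫ |f| ≤ -∫ u·∇v`
(`HasDiv.integrable_and_integral_abs_le`), while `𝒟(u) ≤ ∫ |f|` is immediate from `div u = f`.
Equality in the duality inequality says exactly that `-∇v` is a subgradient of `𝒟` at `u`, so the
divergence flow is a gradient flow.

Uniqueness of `u` is the contraction property of gradient flows: the subdifferential is monotone, so
the distance between two solutions does not increase. From `u` one recovers `∇v = u_t` almost
everywhere. The domain may be unbounded, without Poincaré inequality, so `v` is recovered from `∇v`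
through a weighted Hardy-type inequality. Finally `g χ_E = div u` determines `E` where `g ≠ 0`, and
the sign of `g` separates `E^+` from `E^-`. -/

/-- Termwise comparison of the sums in the definition. It serves to compare the norm of a
Hilbert-valued primitive with the scalar primitive of the norm. -/
theorem absolutelyContinuousOnInterval_of_dist_le {X Y : Type*} [PseudoMetricSpace X]
    [PseudoMetricSpace Y] {f : ℝ → X} {F : ℝ → Y} {a b : ℝ}
    (hF : AbsolutelyContinuousOnInterval F a b)
    (h : ∀ x ∈ uIcc a b, ∀ y ∈ uIcc a b, dist (f x) (f y) ≤ dist (F x) (F y)) :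
    AbsolutelyContinuousOnInterval f a b := by
  rw [absolutelyContinuousOnInterval_iff] at hF ⊢
  intro ε hε
  obtain ⟨δ, hδ, H⟩ := hF ε hε
  refine ⟨δ, hδ, fun E hE hlen => lt_of_le_of_lt (Finset.sum_le_sum fun i hi => ?_) (H E hE hlen)⟩
  have := hE.1 i hi
  exact h _ this.1 _ this.2

/-! ### Energy estimates for curves in a Hilbert space. -/

section Hilbert

variable {H : Type*} [NormedAddCommGroup H] [InnerProductSpace ℝ H] [CompleteSpace H]

/-- The squared norm of an absolutely continuous curve does not increase when the velocity has
nonpositive inner product with the position. -/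
theorem norm_sq_le_of_inner_deriv_nonpos {w w' : ℝ → H} {a b : ℝ} (hab : a ≤ b)
    (hint : IntervalIntegrable w' volume a b)
    (hw : ∀ t ∈ Icc a b, w t = w a + ∫ r in a..t, w' r)
    (hneg : ∀ᵐ t ∂(volume.restrict (Ioo a b)), inner ℝ (w' t) (w t) ≤ 0) :
    ‖w b‖ ^ 2 ≤ ‖w a‖ ^ 2 := by
  -- The hypothesis describes `w` only on `[a, b]`; `W` is a primitive on the whole line, to which
  -- the differentiation theorem applies directly.
  set W : ℝ → H := fun t => w a + ∫ r in a..t, w' r with hW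
  have hsub : ∀ x ∈ uIcc a b, ∀ y ∈ uIcc a b,
      dist ‖W x‖ ‖W y‖ ≤ dist (∫ r in a..x, ‖w' r‖) (∫ r in a..y, ‖w' r‖) := by
    intro x hx y hy
    have hax : IntervalIntegrable w' volume a x := hint.mono_set (uIcc_subset_uIcc left_mem_uIcc hx)
    have hay : IntervalIntegrable w' volume a y := hint.mono_set (uIcc_subset_uIcc left_mem_uIcc hy)
    refine (dist_norm_norm_le _ _).trans ?_
    rw [hW, add_sub_add_left_eq_sub, intervalIntegral.integral_interval_sub_left hax hay,
      Real.dist_eq, intervalIntegral.integral_interval_sub_left hax.norm hay.norm]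
    exact intervalIntegral.norm_integral_le_abs_integral_norm
  have hac1 : AbsolutelyContinuousOnInterval (fun t => ‖W t‖) a b :=
    absolutelyContinuousOnInterval_of_dist_le
      (hint.norm.absolutelyContinuousOnInterval_intervalIntegral left_mem_uIcc) hsub
  have hac := hac1.mul hac1
  have hder : ∀ᵐ t, t ∈ uIcc a b → HasDerivAt W (w' t) t := by
    filter_upwards [hint.ae_hasDerivAt_integral] with t ht hmem
    exact (ht hmem a left_mem_uIcc).const_add _
  have h0 := hac.integral_deriv_eq_sub
  have hWw : ∀ t ∈ Icc a b, W t = w t := fun t ht => (hw t ht).symm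
  have hle : ∫ x in a..b, deriv ((fun t => ‖W t‖) * fun t => ‖W t‖) x ≤ 0 := by
    rw [intervalIntegral.integral_of_le hab, integral_Ioc_eq_integral_Ioo]
    refine integral_nonpos_of_ae ?_
    filter_upwards [hneg, ae_restrict_of_ae hder, ae_restrict_mem measurableSet_Ioo]
      with t h1 h2 h3
    have h3' : t ∈ Icc a b := Ioo_subset_Icc_self h3
    have h4 := (h2 (by rwa [uIcc_of_le hab])).norm_sq
    have h5 : ((fun t => ‖W t‖) * fun t => ‖W t‖) = fun t => ‖W t‖ ^ 2 := by
      ext t; simp [sq]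
    rw [h5, h4.deriv, hWw t h3', real_inner_comm]
    simp only [Pi.zero_apply]
    linarith
  rw [h0] at hle
  simp only [Pi.mul_apply, hWw b (right_mem_Icc.2 hab), hWw a (left_mem_Icc.2 hab)] at hle
  nlinarith

/-- The velocity need not be integrable up to time `0`, so the energy estimate is used on `[s, t]`
with `s > 0`, and continuity at `0` allows `s → 0`. -/
theorem eqOn_zero_of_inner_deriv_nonpos {w w' : ℝ → H} {T : ℝ} (hcont : ContinuousOn w (Ico 0 T))
    (h0 : w 0 = 0)
    (hint : ∀ s t, 0 < s → s < t → t < T →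
      IntervalIntegrable w' volume s t ∧ w t - w s = ∫ r in s..t, w' r)
    (hneg : ∀ᵐ t ∂(volume.restrict (Ioo 0 T)), inner ℝ (w' t) (w t) ≤ 0) :
    EqOn w 0 (Ico 0 T) := by
  intro t ht
  rcases ht.1.eq_or_lt with rfl | hpos
  · exact h0
  have hmono : ∀ s, 0 < s → s < t → ‖w t‖ ^ 2 ≤ ‖w s‖ ^ 2 := by
    intro s hs hst
    refine norm_sq_le_of_inner_deriv_nonpos hst.le (hint s t hs hst ht.2).1 ?_
      (ae_restrict_of_ae_restrict_of_subset (Ioo_subset_Ioo hs.le ht.2.le) hneg)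
    intro r hr
    rcases hr.1.eq_or_lt with rfl | hsr
    · simp
    · rw [← (hint s r hs hsr (hr.2.trans_lt ht.2)).2]; abel
  have hlim : Tendsto (fun s => ‖w s‖ ^ 2) (𝓝[>] 0) (𝓝 (‖w 0‖ ^ 2)) := by
    have h1 : Tendsto w (𝓝[Ico 0 T] 0) (𝓝 (w 0)) := hcont 0 ⟨le_rfl, hpos.trans ht.2⟩
    have h2 : 𝓝[>] (0 : ℝ) ≤ 𝓝[Ico 0 T] 0 := by
      rw [← nhdsWithin_Ioo_eq_nhdsGT (hpos.trans ht.2)]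
      exact nhdsWithin_mono _ Ioo_subset_Ico_self
    exact ((h1.mono_left h2).norm).pow 2
  have hle : ‖w t‖ ^ 2 ≤ ‖w 0‖ ^ 2 := by
    refine ge_of_tendsto hlim ?_
    filter_upwards [Ioo_mem_nhdsGT hpos] with s hs using hmono s hs.1 hs.2
  rw [h0, norm_zero] at hle
  have : ‖w t‖ = 0 := by nlinarith [norm_nonneg (w t)]
  simpa using this

end Hilbert

/-! ### Monotonicity of the subdifferential and uniqueness of the gradient flow. -/

variable {N : ℕ} {A : Set (Sp N)}

theorem isTest_zero : IsTest A (fun _ => 0) :=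
  ⟨contDiff_const, HasCompactSupport.zero, by simp [tsupport]⟩

theorem totalDiv_nonneg (u : L2Vec A) : 0 ≤ totalDiv A u := by
  refine le_trans ?_ (le_iSup₂ (f := fun (φ : Sp N → ℝ) (_ : IsTest A φ ∧ ∀ x, |φ x| ≤ 1) =>
    ((∫ x in A, - inner ℝ (u x) (gradient φ x) : ℝ) : EReal)) (fun _ => 0) ⟨isTest_zero, by simp⟩)
  simp [gradient_fun_const']

theorem totalDiv_zero : totalDiv A (0 : L2Vec A) = 0 := by
  refine le_antisymm (iSup₂_le fun φ _ => ?_) (totalDiv_nonneg _)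
  have : ∫ x in A, - inner ℝ ((0 : L2Vec A) x) (gradient φ x) = 0 := by
    rw [← integral_zero (Sp N) ℝ]
    refine integral_congr_ae ?_
    filter_upwards [Lp.coeFn_zero (Sp N) 2 (volume.restrict A)] with x hx
    rw [hx, Pi.zero_apply, inner_zero_left, neg_zero]
  rw [this, EReal.coe_zero]

theorem totalDiv_ne_top_of_mem_subdiff {u q : L2Vec A} (h : q ∈ subdiff A u) :
    totalDiv A u ≠ ⊤ := by
  intro htop
  have := h 0
  rw [htop, totalDiv_zero, EReal.top_add_coe] at this
  simp at this

/-- Each subgradient inequality is tested at the other point and the two are added; the values of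
`𝒟` cancel because they are finite. -/
theorem inner_sub_nonneg_of_mem_subdiff {u₁ u₂ q₁ q₂ : L2Vec A} (h₁ : q₁ ∈ subdiff A u₁)
    (h₂ : q₂ ∈ subdiff A u₂) : 0 ≤ inner ℝ (q₁ - q₂) (u₁ - u₂) := by
  have e₁ := h₁ u₂
  have e₂ := h₂ u₁
  have f₁ := totalDiv_ne_top_of_mem_subdiff h₁
  have f₂ := totalDiv_ne_top_of_mem_subdiff h₂
  have g₁ : totalDiv A u₁ ≠ ⊥ := ne_bot_of_le_ne_bot (by simp) (totalDiv_nonneg u₁)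
  have g₂ : totalDiv A u₂ ≠ ⊥ := ne_bot_of_le_ne_bot (by simp) (totalDiv_nonneg u₂)
  lift totalDiv A u₁ to ℝ using ⟨f₁, g₁⟩ with d₁
  lift totalDiv A u₂ to ℝ using ⟨f₂, g₂⟩ with d₂
  norm_cast at e₁ e₂
  have : inner ℝ q₁ (u₂ - u₁) = - inner ℝ q₁ (u₁ - u₂) := by rw [← inner_neg_right, neg_sub]
  rw [inner_sub_left]
  linarith

theorem IsGradientFlow.eqOn {T : ℝ} {u₀ : L2Vec A} {u₁ u₂ : ℝ → L2Vec A}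
    (h₁ : IsGradientFlow A T u₀ u₁) (h₂ : IsGradientFlow A T u₀ u₂) : EqOn u₁ u₂ (Ico 0 T) := by
  obtain ⟨w₁, hw₁, hs₁⟩ := h₁.flow
  obtain ⟨w₂, hw₂, hs₂⟩ := h₂.flow
  have := eqOn_zero_of_inner_deriv_nonpos (w := fun t => u₁ t - u₂ t) (w' := fun t => w₁ t - w₂ t)
    (h₁.cont.sub h₂.cont) (by simp [h₁.init, h₂.init]) (fun s t hs hst ht => by
      obtain ⟨i₁, e₁⟩ := hw₁ s t hs hst ht
      obtain ⟨i₂, e₂⟩ := hw₂ s t hs hst ht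
      refine ⟨i₁.sub i₂, ?_⟩
      rw [intervalIntegral.integral_sub i₁ i₂, ← e₁, ← e₂]; abel)
    (by
      filter_upwards [hs₁, hs₂] with t h1 h2
      have := inner_sub_nonneg_of_mem_subdiff h1 h2
      rw [neg_sub_neg, ← neg_sub (w₁ t), inner_neg_left] at this
      linarith)
  exact fun t ht => sub_eq_zero.1 (this ht)

/-! ### Calculus of test functions and bounded approximation in `H^1_0`. -/

theorem gradient_mul {f h : Sp N → ℝ} {x : Sp N} (hf : DifferentiableAt ℝ f x)
    (hh : DifferentiableAt ℝ h x) :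
    gradient (fun y => f y * h y) x = f x • gradient h x + h x • gradient f x := by
  simp only [gradient]
  rw [fderiv_fun_mul hf hh]
  simp

theorem gradient_comp {τ : ℝ → ℝ} {f : Sp N → ℝ} {x : Sp N} (hτ : DifferentiableAt ℝ τ (f x))
    (hf : DifferentiableAt ℝ f x) :
    gradient (fun y => τ (f y)) x = deriv τ (f x) • gradient f x := by
  simp only [gradient]
  have : fderiv ℝ (fun y => τ (f y)) x = deriv τ (f x) • fderiv ℝ f x :=
    (hτ.hasDerivAt.comp_hasFDerivAt x hf.hasFDerivAt).fderiv
  rw [this]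
  simp

theorem norm_gradient (f : Sp N → ℝ) (x : Sp N) : ‖gradient f x‖ = ‖fderiv ℝ f x‖ := by
  simp [gradient]

theorem continuous_gradient {f : Sp N → ℝ} (hf : ContDiff ℝ ∞ f) : Continuous (gradient f) :=
  (InnerProductSpace.toDual ℝ (Sp N)).symm.continuous.comp (hf.continuous_fderiv (by simp))

theorem hasCompactSupport_gradient {f : Sp N → ℝ} (hf : HasCompactSupport f) :
    HasCompactSupport (gradient f) :=
  (hf.fderiv (𝕜 := ℝ)).comp_left (g := (InnerProductSpace.toDual ℝ (Sp N)).symm) (map_zero _)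

namespace IsTest

variable {φ : Sp N → ℝ}

theorem continuous (h : IsTest A φ) : Continuous φ := h.smooth.continuous

theorem memLp (h : IsTest A φ) (q : ENNReal) : MemLp φ q (volume.restrict A) :=
  h.continuous.memLp_of_hasCompactSupport h.compact

theorem memLp_gradient (h : IsTest A φ) (q : ENNReal) :
    MemLp (gradient φ) q (volume.restrict A) :=
  (continuous_gradient h.smooth).memLp_of_hasCompactSupport (hasCompactSupport_gradient h.compact)

theorem mul_left (h : IsTest A φ) {χ : Sp N → ℝ} (hχ : ContDiff ℝ ∞ χ) :
    IsTest A (fun x => χ x * φ x) :=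
  ⟨hχ.mul h.smooth, h.compact.mul_left, (tsupport_mul_subset_right (f := χ)).trans h.supp⟩

theorem comp_left (h : IsTest A φ) {τ : ℝ → ℝ} (hτ : ContDiff ℝ ∞ τ) (h0 : τ 0 = 0) :
    IsTest A (fun x => τ (φ x)) :=
  ⟨hτ.comp h.smooth, h.compact.comp_left h0, (tsupport_comp_subset h0 φ).trans h.supp⟩

end IsTest

/-- A smooth truncation: the identity on `[-c, c]`, with values in `[-1, 1]` and slope in
`[0, 1]`. -/
theorem exists_smooth_truncation {c : ℝ} (hc0 : 0 < c) (hc1 : c < 1) :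
    ∃ τ : ℝ → ℝ, ContDiff ℝ ∞ τ ∧ (∀ s, |s| ≤ c → τ s = s) ∧ (∀ s, |τ s| ≤ 1) ∧
      (∀ s, |deriv τ s| ≤ 1) ∧ ∀ s, |s| ≤ c → deriv τ s = 1 := by
  -- The truncation is the primitive of this bump: slope one on `[-c, c]`, slope zero outside `[-1,
  -- 1]`, hence values in `[-1, 1]`.
  let κ : ContDiffBump (0 : ℝ) := ⟨c, 1, hc0, hc1⟩
  have hκi : ∀ a b, IntervalIntegrable κ volume a b := fun a b => κ.continuous.intervalIntegrable a b
  have hder : ∀ s, HasDerivAt (fun s => ∫ r in (0 : ℝ)..s, κ r) (κ s) s := fun s =>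
    intervalIntegral.integral_hasDerivAt_right (hκi _ _)
      (κ.continuous.stronglyMeasurableAtFilter _ _) κ.continuous.continuousAt
  have hderiv : deriv (fun s => ∫ r in (0 : ℝ)..s, κ r) = κ := funext fun s => (hder s).deriv
  have hone : ∀ s, |s| ≤ c → κ s = 1 := fun s hs =>
    κ.one_of_mem_closedBall (by simpa [κ] using hs)
  have hzero : ∀ s, 1 ≤ |s| → κ s = 0 := fun s hs =>
    κ.zero_of_le_dist (by simpa [κ] using hs)
  have habs : ∀ s, |κ s| ≤ 1 := fun s => by rw [abs_of_nonneg κ.nonneg]; exact κ.le_one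
  have hle : ∀ s, |∫ r in (0 : ℝ)..s, κ r| ≤ |s| := by
    intro s
    have := intervalIntegral.norm_integral_le_of_norm_le_const (a := 0) (b := s) (f := κ) (C := 1)
      (fun r _ => habs r)
    simpa using this
  refine ⟨fun s => ∫ r in (0 : ℝ)..s, κ r, ?_, ?_, ?_, ?_, ?_⟩
  · rw [contDiff_infty_iff_deriv, hderiv]
    exact ⟨fun s => (hder s).differentiableAt, κ.contDiff⟩
  · intro s hs
    have : ∫ r in (0 : ℝ)..s, κ r = ∫ r in (0 : ℝ)..s, (1 : ℝ) := by
      refine intervalIntegral.integral_congr fun r hr => hone r ?_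
      rw [mem_uIcc] at hr
      rw [abs_le] at hs ⊢
      constructor <;> rcases hr with hr | hr <;> linarith [hr.1, hr.2, hs.1, hs.2]
    simp [this]
  · intro s
    have hz : ∀ e, |e| = 1 → (∀ r ∈ uIcc e s, 1 ≤ |r|) → |∫ r in (0 : ℝ)..s, κ r| ≤ 1 := by
      intro e he hr
      have h1 : ∫ r in e..s, κ r = 0 := by
        rw [intervalIntegral.integral_congr (g := fun _ => 0) fun r h => hzero r (hr r h)]
        simp
      rw [← intervalIntegral.integral_add_adjacent_intervals (hκi 0 e) (hκi e s), h1, add_zero]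
      exact (hle e).trans he.le
    rcases le_or_gt |s| 1 with h | h
    · exact (hle s).trans h
    · rcases lt_abs.1 h with h | h
      · refine hz 1 (by simp) fun r hr => ?_
        rw [uIcc_of_le h.le] at hr
        exact le_abs.2 (Or.inl hr.1)
      · refine hz (-1) (by simp) fun r hr => ?_
        rw [uIcc_of_ge (by linarith)] at hr
        exact le_abs.2 (Or.inr (by linarith [hr.2]))
  · intro s; rw [hderiv]; exact habs s
  · intro s hs; rw [hderiv]; exact hone s hs

theorem integrable_inner {u w : Sp N → Sp N} (hu : MemLp u 2 (volume.restrict A))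
    (hw : MemLp w 2 (volume.restrict A)) :
    Integrable (fun x => inner ℝ (u x) (w x)) (volume.restrict A) :=
  (hu.norm.integrable_mul hw.norm).mono' (hu.1.inner hw.1)
    (ae_of_all _ fun _ => norm_inner_le_norm _ _)

/-- Elements of `H^1_0(A)` bounded by one are, up to a factor, limits of test functions bounded
by one: almost everywhere for the values, and weakly in `L²` for the gradients. -/
theorem H10.exists_bounded_test_seq (v : H10 A)
    (hv : ∀ᵐ x ∂(volume.restrict A), |H10.fn v x| ≤ 1) {c : ℝ} (hc0 : 0 < c) (hc1 : c < 1) :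
    ∃ φ : ℕ → Sp N → ℝ, (∀ n, IsTest A (φ n)) ∧ (∀ n x, |φ n x| ≤ 1) ∧
      (∀ᵐ x ∂(volume.restrict A), Tendsto (fun n => φ n x) atTop (𝓝 (c * H10.fn v x))) ∧
      ∀ z : L2Vec A, Tendsto (fun n => ∫ x in A, inner ℝ (z x) (gradient (φ n) x)) atTop
        (𝓝 (c * ∫ x in A, inner ℝ (z x) (H10.grad v x))) := by
  obtain ⟨τ, hτ, hτid, hτ1, hτd1, hτd⟩ := exists_smooth_truncation hc0 hc1
  have hmem : v.1 ∈ closure (testGraph A : Set (L2 A × L2Vec A)) := v.2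
  obtain ⟨q, hq, hlim⟩ := mem_closure_iff_seq_limit.1 hmem
  have hlim1 : Tendsto (fun n => (q n).1) atTop (𝓝 (H10.fn v)) :=
    (continuous_fst.tendsto _).comp hlim
  obtain ⟨ns, hns, hae⟩ := (tendstoInMeasure_of_tendsto_Lp hlim1).exists_seq_tendsto_ae
  have hlim2 : Tendsto (fun n => (q (ns n)).2) atTop (𝓝 (H10.grad v)) :=
    ((continuous_snd.tendsto _).comp hlim).comp hns.tendsto_atTop
  choose ψ hψ h1 h2 using fun n => hq (ns n)
  have hτ0 : τ 0 = 0 := hτid 0 (by simpa using hc0.le)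
  have hdτ : Continuous (deriv τ) := hτ.continuous_deriv (by simp)
  have hdiff : Differentiable ℝ τ := hτ.differentiable (by simp)
  have hcτ : ContDiff ℝ ∞ fun s => τ (c * s) := hτ.comp (contDiff_const.mul contDiff_id)
  have hτc : ∀ s, |s| ≤ 1 → |c * s| ≤ c := fun s hs => by
    rw [abs_mul, abs_of_pos hc0]; exact mul_le_of_le_one_right hc0.le hs
  have hψae : ∀ᵐ x ∂(volume.restrict A), Tendsto (fun n => ψ n x) atTop (𝓝 (H10.fn v x)) := by
    filter_upwards [hae, ae_all_iff.2 h1] with x hx hx1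
    exact hx.congr hx1
  -- Scaling by `c` puts the limit `c v` into `[-c, c]`, where `τ` is the identity and `τ' = 1`.
  refine ⟨fun n x => τ (c * ψ n x), fun n => (hψ n).comp_left hcτ (by simpa using hτ0),
    fun n x => hτ1 _, ?_, fun z => ?_⟩
  · filter_upwards [hψae, hv] with x hx hx1
    have := (hτ.continuous.tendsto (c * H10.fn v x)).comp (hx.const_mul c)
    rwa [hτid _ (hτc _ hx1)] at this
  -- The factor `τ'(c ψ n)` of the gradient is moved onto `z`. The resulting fields are bounded in
  -- `L²`, so `∇ψ n` may be replaced by its strong limit `∇v` (`hA`); dominated convergence then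
  -- removes the factor (`hB`).
  · have hzn : ∀ n, MemLp (fun x => deriv τ (c * ψ n x) • z x) 2 (volume.restrict A) := fun n =>
      (Lp.memLp z).of_le ((hdτ.comp (continuous_const.mul (hψ n).continuous)).aestronglyMeasurable.smul
        (Lp.aestronglyMeasurable z)) (ae_of_all _ fun x => by
          rw [norm_smul]; exact mul_le_of_le_one_left (norm_nonneg _) (hτd1 _))
    have hnorm : ∀ n, ‖(hzn n).toLp‖ ≤ ‖z‖ := fun n => by
      refine Lp.norm_le_norm_of_ae_le ?_
      filter_upwards [(hzn n).coeFn_toLp] with x hx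
      rw [hx, norm_smul]; exact mul_le_of_le_one_left (norm_nonneg _) (hτd1 _)
    have hA : Tendsto (fun n => inner ℝ (hzn n).toLp ((q (ns n)).2 - H10.grad v)) atTop (𝓝 0) := by
      have hb : Tendsto (fun n => ‖z‖ * ‖(q (ns n)).2 - H10.grad v‖) atTop (𝓝 0) := by
        have := (tendsto_iff_norm_sub_tendsto_zero.1 hlim2).const_mul ‖z‖
        simpa using this
      refine squeeze_zero_norm (fun n => ?_) hb
      exact (norm_inner_le_norm _ _).trans
        (mul_le_mul_of_nonneg_right (hnorm n) (norm_nonneg _))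
    have hB : Tendsto (fun n => inner ℝ (hzn n).toLp (H10.grad v)) atTop
        (𝓝 (∫ x in A, inner ℝ (z x) (H10.grad v x))) := by
      have hint := L2.integrable_inner (𝕜 := ℝ) z (H10.grad v)
      have hd : Tendsto (fun n => ∫ x in A, deriv τ (c * ψ n x) * inner ℝ (z x) (H10.grad v x))
          atTop (𝓝 (∫ x in A, inner ℝ (z x) (H10.grad v x))) := by
        refine tendsto_integral_of_dominated_convergence
          (fun x => ‖(inner ℝ (z x) (H10.grad v x) : ℝ)‖) (fun n => ?_) hint.norm
          (fun n => ae_of_all _ fun x => ?_) ?_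
        · exact (hdτ.comp (continuous_const.mul (hψ n).continuous)).aestronglyMeasurable.mul
            hint.aestronglyMeasurable
        · rw [norm_mul]; exact mul_le_of_le_one_left (norm_nonneg _) (hτd1 _)
        · filter_upwards [hψae, hv] with x hx hx1
          have := ((hdτ.tendsto (c * H10.fn v x)).comp (hx.const_mul c)).mul_const
            (inner ℝ (z x) (H10.grad v x) : ℝ)
          rwa [hτd _ (hτc _ hx1), one_mul] at this
      refine hd.congr fun n => ?_
      rw [L2.inner_def]
      refine integral_congr_ae ?_
      filter_upwards [(hzn n).coeFn_toLp] with x hx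
      rw [hx, real_inner_smul_left]
    have hC := (hA.add hB).const_mul c
    rw [zero_add] at hC
    refine hC.congr fun n => ?_
    rw [← inner_add_right, sub_add_cancel, L2.inner_def, ← integral_const_mul]
    refine integral_congr_ae ?_
    filter_upwards [(hzn n).coeFn_toLp, h2 n] with x hx hx2
    rw [hx, hx2, gradient_comp (τ := fun s => τ (c * s)) (hcτ.differentiable (by simp) _)
      ((hψ n).differentiableAt x), real_inner_smul_left, real_inner_smul_right,
      deriv_comp_mul_left, smul_eq_mul, mul_assoc]

/-! ### Duality and the subgradient inclusion. -/

/-- Duality: `-∫ z·∇v ≤ 𝒟(z)` when `v ∈ H^1_0(A)` and `|v| ≤ 1`. -/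
theorem neg_integral_inner_grad_le_totalDiv (z : L2Vec A) (v : H10 A)
    (hv : ∀ᵐ x ∂(volume.restrict A), |H10.fn v x| ≤ 1) :
    ((-∫ x in A, inner ℝ (z x) (H10.grad v x) : ℝ) : EReal) ≤ totalDiv A z := by
  set I := ∫ x in A, inner ℝ (z x) (H10.grad v x)
  have key : ∀ c ∈ Ioo (0 : ℝ) 1, ((-(c * I) : ℝ) : EReal) ≤ totalDiv A z := by
    intro c hc
    obtain ⟨φ, hφ, hb, -, hlim⟩ := H10.exists_bounded_test_seq v hv hc.1 hc.2
    have h1 : Tendsto (fun n => ((-∫ x in A, inner ℝ (z x) (gradient (φ n) x) : ℝ) : EReal)) atTop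
        (𝓝 ((-(c * I) : ℝ) : EReal)) :=
      (continuous_coe_real_ereal.tendsto _).comp (hlim z).neg
    refine le_of_tendsto' h1 fun n => ?_
    rw [← integral_neg]
    exact le_iSup₂ (f := fun (φ : Sp N → ℝ) (_ : IsTest A φ ∧ ∀ x, |φ x| ≤ 1) =>
      ((∫ x in A, - inner ℝ (z x) (gradient φ x) : ℝ) : EReal)) (φ n) ⟨hφ n, hb n⟩
  have hlim : Tendsto (fun c : ℝ => ((-(c * I) : ℝ) : EReal)) (𝓝[<] 1) (𝓝 ((-I : ℝ) : EReal)) := by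
    refine (continuous_coe_real_ereal.tendsto _).comp ?_
    have : Continuous fun c : ℝ => -(c * I) := by fun_prop
    simpa using (this.tendsto 1).mono_left nhdsWithin_le_nhds
  refine le_of_tendsto hlim ?_
  filter_upwards [Ioo_mem_nhdsLT (zero_lt_one' ℝ)] with c hc using key c hc

/-- Fatou's lemma for real functions with bounded integrals. -/
theorem integrable_and_integral_le_of_tendsto {α : Type*} [MeasurableSpace α] {μ : Measure α}
    {F : ℕ → α → ℝ} {f : α → ℝ} {b : ℕ → ℝ} {B : ℝ} (hF : ∀ n, Integrable (F n) μ)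
    (h0 : ∀ n, 0 ≤ᵐ[μ] F n) (hlim : ∀ᵐ x ∂μ, Tendsto (fun n => F n x) atTop (𝓝 (f x)))
    (hb : ∀ n, ∫ x, F n x ∂μ ≤ b n) (hB : Tendsto b atTop (𝓝 B)) :
    Integrable f μ ∧ ∫ x, f x ∂μ ≤ B := by
  have hf0 : 0 ≤ᵐ[μ] f := by
    filter_upwards [hlim, ae_all_iff.2 h0] with x hx h
    exact ge_of_tendsto' hx h
  have hfm : AEStronglyMeasurable f μ := aestronglyMeasurable_of_tendsto_ae atTop (fun n => (hF n).1) hlim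
  have hB0 : 0 ≤ B := ge_of_tendsto' hB fun n => (integral_nonneg_of_ae (h0 n)).trans (hb n)
  have hle : ∫⁻ x, ENNReal.ofReal (f x) ∂μ ≤ ENNReal.ofReal B := by
    calc ∫⁻ x, ENNReal.ofReal (f x) ∂μ
        = ∫⁻ x, liminf (fun n => ENNReal.ofReal (F n x)) atTop ∂μ := by
          refine lintegral_congr_ae ?_
          filter_upwards [hlim] with x hx
          exact ((ENNReal.continuous_ofReal.tendsto _).comp hx).liminf_eq.symm
      _ ≤ liminf (fun n => ∫⁻ x, ENNReal.ofReal (F n x) ∂μ) atTop :=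
          lintegral_liminf_le' fun n => (hF n).1.aemeasurable.ennreal_ofReal
      _ ≤ liminf (fun n => ENNReal.ofReal (b n)) atTop := by
          refine liminf_le_liminf (Eventually.of_forall fun n => ?_)
          rw [← ofReal_integral_eq_lintegral_ofReal (hF n) (h0 n)]
          exact ENNReal.ofReal_le_ofReal (hb n)
      _ = ENNReal.ofReal B := ((ENNReal.continuous_ofReal.tendsto _).comp hB).liminf_eq
  refine ⟨⟨hfm, ?_⟩, ?_⟩
  · rw [hasFiniteIntegral_iff_ofReal hf0]
    exact hle.trans_lt ENNReal.ofReal_lt_top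
  · rw [integral_eq_lintegral_of_nonneg_ae hf0 hfm]
    exact ENNReal.toReal_le_of_le_ofReal hB0 hle

/-- Extremality gives `𝒟(u) - ∫ ∇v·(z - u) = -∫ z·∇v`, and duality bounds the right side by `𝒟(z)`:
this is the subgradient inequality for `-∇v`. -/
theorem IsDivFlow.isGradientFlow {T : ℝ} {u₀ : L2Vec A} {u : ℝ → L2Vec A} {v : ℝ → H10 A}
    (h : IsDivFlow A T u₀ u v) : IsGradientFlow A T u₀ u := by
  refine ⟨h.cont, h.init, fun t => H10.grad (v t), h.evol, ?_⟩
  filter_upwards [h.bound, h.extremal] with t hb he z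
  refine le_trans (le_of_eq ?_) (neg_integral_inner_grad_le_totalDiv z (v t) hb)
  have hne : totalDiv A (u t) ≠ ⊤ := by
    intro htop; rw [htop, EReal.top_add_coe] at he; simp at he
  have hnb : totalDiv A (u t) ≠ ⊥ := ne_bot_of_le_ne_bot (by simp) (totalDiv_nonneg _)
  lift totalDiv A (u t) to ℝ using ⟨hne, hnb⟩ with d
  norm_cast at he ⊢
  rw [← L2.inner_def] at he ⊢
  rw [inner_neg_left, inner_sub_right, real_inner_comm z, real_inner_comm (u t)]
  linarith

/-! ### The Brezis–Browder argument and extremality of `v`. -/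

/-- Integration by parts against `χ v`, with `v ∈ H^1_0(A)` bounded and `χ` a cut-off function. -/
theorem HasDiv.integral_mul_cutoff {u : L2Vec A} {f : Sp N → ℝ} (h : HasDiv A u f)
    (hf : LocallyIntegrable f (volume.restrict A)) {v : H10 A}
    (hv : ∀ᵐ x ∂(volume.restrict A), |H10.fn v x| ≤ 1) {χ : Sp N → ℝ} (hχ : ContDiff ℝ ∞ χ)
    (hχc : HasCompactSupport χ) :
    ∫ x in A, χ x * (f x * H10.fn v x) = -((∫ x in A, χ x * inner ℝ (u x) (H10.grad v x)) +
      ∫ x in A, H10.fn v x * inner ℝ (u x) (gradient χ x)) := by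
  -- The identity is linear in `v`, so any factor in `(0, 1)` would do; the `1/2` cancels at the
  -- end.
  obtain ⟨φ, hφ, hb, hae, hlim⟩ := H10.exists_bounded_test_seq v hv one_half_pos one_half_lt_one
  obtain ⟨C, hC⟩ := hχ.continuous.bounded_above_of_compact_support hχc
  have hfχ : Integrable (fun x => χ x * f x) (volume.restrict A) :=
    hf.integrable_smul_left_of_hasCompactSupport hχ.continuous hχc
  have hχu : MemLp (fun x => χ x • u x) 2 (volume.restrict A) :=
    (Lp.memLp u).of_le_mul (c := C) (hχ.continuous.aestronglyMeasurable.smul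
      (Lp.aestronglyMeasurable u)) (ae_of_all _ fun x => by
        rw [norm_smul]; exact mul_le_mul_of_nonneg_right (hC x) (norm_nonneg _))
  have hgχ : MemLp (gradient χ) 2 (volume.restrict A) :=
    (continuous_gradient hχ).memLp_of_hasCompactSupport (hasCompactSupport_gradient hχc)
  have hug : Integrable (fun x => inner ℝ (u x) (gradient χ x)) (volume.restrict A) :=
    integrable_inner (Lp.memLp u) hgχ
  have e1 : Tendsto (fun n => ∫ x in A, φ n x * (χ x * f x)) atTop
      (𝓝 (∫ x in A, 1 / 2 * H10.fn v x * (χ x * f x))) := by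
    refine tendsto_integral_of_dominated_convergence (fun x => ‖χ x * f x‖)
      (fun n => (hφ n).continuous.aestronglyMeasurable.mul hfχ.1) hfχ.norm
      (fun n => ae_of_all _ fun x => ?_) ?_
    · rw [norm_mul]; exact mul_le_of_le_one_left (norm_nonneg _) (hb n x)
    · filter_upwards [hae] with x hx using hx.mul_const _
  have e2 : Tendsto (fun n => ∫ x in A, φ n x * inner ℝ (u x) (gradient χ x)) atTop
      (𝓝 (∫ x in A, 1 / 2 * H10.fn v x * inner ℝ (u x) (gradient χ x))) := by
    refine tendsto_integral_of_dominated_convergence (fun x => ‖(inner ℝ (u x) (gradient χ x) : ℝ)‖)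
      (fun n => (hφ n).continuous.aestronglyMeasurable.mul hug.1) hug.norm
      (fun n => ae_of_all _ fun x => ?_) ?_
    · rw [norm_mul]; exact mul_le_of_le_one_left (norm_nonneg _) (hb n x)
    · filter_upwards [hae] with x hx using hx.mul_const _
  set z : L2Vec A := hχu.toLp _
  have hze : z =ᵐ[volume.restrict A] fun x => χ x • u x := hχu.coeFn_toLp
  have e3 := hlim z
  have hid : ∀ n, ∫ x in A, φ n x * (χ x * f x) =
      -((∫ x in A, inner ℝ (z x) (gradient (φ n) x)) +
        ∫ x in A, φ n x * inner ℝ (u x) (gradient χ x)) := by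
    intro n
    have h1 := h _ ((hφ n).mul_left hχ)
    rw [← neg_eq_iff_eq_neg] at h1
    rw [← integral_add (integrable_inner (Lp.memLp _) ((hφ n).memLp_gradient 2))
      (hug.bdd_mul (c := 1) (hφ n).continuous.aestronglyMeasurable (ae_of_all _ (hb n)))]
    have h2 : ∫ x in A, φ n x * (χ x * f x) = ∫ x in A, f x * (χ x * φ n x) :=
      integral_congr_ae (ae_of_all _ fun x => by ring)
    rw [h2, ← h1]
    congr 1
    refine integral_congr_ae ?_
    filter_upwards [hze] with x hx
    rw [hx, gradient_mul (hχ.differentiable (by simp) x) ((hφ n).differentiableAt x),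
      inner_add_right, real_inner_smul_left, real_inner_smul_right, real_inner_smul_right]
  have hlast := tendsto_nhds_unique (e1.congr hid) ((e3.add e2).neg)
  have e4 : ∫ x in A, inner ℝ (z x) (H10.grad v x) =
      ∫ x in A, χ x * inner ℝ (u x) (H10.grad v x) := by
    refine integral_congr_ae ?_
    filter_upwards [hze] with x hx
    rw [hx, real_inner_smul_left]
  simp_rw [mul_assoc] at hlast
  rw [integral_const_mul, integral_const_mul, e4] at hlast
  have e5 : ∫ x in A, χ x * (f x * H10.fn v x) = ∫ x in A, H10.fn v x * (χ x * f x) :=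
    integral_congr_ae (ae_of_all _ fun x => by ring)
  rw [e5]
  linarith

theorem gradient_comp_smul {χ : Sp N → ℝ} (hχ : Differentiable ℝ χ) (c : ℝ) (x : Sp N) :
    gradient (fun y => χ (c • y)) x = c • gradient χ (c • x) := by
  have h1 : HasFDerivAt (fun y => χ (c • y))
      ((fderiv ℝ χ (c • x)).comp (c • ContinuousLinearMap.id ℝ (Sp N))) x :=
    (hχ (c • x)).hasFDerivAt.comp x ((hasFDerivAt_id x).const_smul c)
  simp only [gradient]
  rw [h1.fderiv]
  have : (fderiv ℝ χ (c • x)).comp (c • ContinuousLinearMap.id ℝ (Sp N)) =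
      c • fderiv ℝ χ (c • x) := by ext; simp
  rw [this]
  simp

/-- A theorem of Brezis–Browder type: if `div u = f` and `f v = |f|`, `v ∈ H^1_0(A)`, `|v| ≤ 1`,
then `f` is integrable and `∫ |f| ≤ -∫ u·∇v`. -/
theorem HasDiv.integrable_and_integral_abs_le {u : L2Vec A} {f : Sp N → ℝ} (h : HasDiv A u f)
    (hf : LocallyIntegrable f (volume.restrict A)) {v : H10 A}
    (hv : ∀ᵐ x ∂(volume.restrict A), |H10.fn v x| ≤ 1)
    (hfv : ∀ᵐ x ∂(volume.restrict A), f x * H10.fn v x = |f x|) :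
    Integrable f (volume.restrict A) ∧
      ∫ x in A, |f x| ≤ -∫ x in A, inner ℝ (u x) (H10.grad v x) := by
  let χ : ContDiffBump (0 : Sp N) := ⟨1, 2, one_pos, one_lt_two⟩
  obtain ⟨C, hC⟩ := (continuous_gradient (f := χ) χ.contDiff).bounded_above_of_compact_support
    (hasCompactSupport_gradient χ.hasCompactSupport)
  have hC0 : 0 ≤ C := (norm_nonneg _).trans (hC 0)
  let c : ℕ → ℝ := fun k => 1 / ((k : ℝ) + 1)
  have hc0 : ∀ k, 0 < c k := fun k => by positivity
  have hclim : Tendsto c atTop (𝓝 0) := tendsto_one_div_add_atTop_nhds_zero_nat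
  -- Dilated cut-offs tend to `1` pointwise with gradients of size `c k * C → 0`. As `v` and `u` are
  -- both in `L²`, the term containing `∇X k` disappears in the limit.
  let X : ℕ → Sp N → ℝ := fun k x => χ (c k • x)
  have hX : ∀ k, ContDiff ℝ ∞ (X k) := fun k => χ.contDiff.comp (contDiff_const_smul _)
  have hXc : ∀ k, HasCompactSupport (X k) := fun k =>
    χ.hasCompactSupport.comp_smul (hc0 k).ne'
  have hX0 : ∀ k x, 0 ≤ X k x := fun k x => χ.nonneg
  have hX1 : ∀ k x, ‖X k x‖ ≤ 1 := fun k x => by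
    rw [Real.norm_of_nonneg (hX0 k x)]; exact χ.le_one
  have hXlim : ∀ x, Tendsto (fun k => X k x) atTop (𝓝 1) := by
    intro x
    have h1 : Tendsto (fun k => c k • x) atTop (𝓝 0) := by
      simpa using hclim.smul_const x
    have h2 := (χ.continuous.tendsto 0).comp h1
    rwa [χ.one_of_mem_closedBall (by simp [χ])] at h2
  have hgX : ∀ k x, ‖gradient (X k) x‖ ≤ c k * C := fun k x => by
    rw [show gradient (X k) x = c k • gradient χ (c k • x) from
      gradient_comp_smul (χ.contDiff.differentiable (n := 1) (by simp)) _ _, norm_smul,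
      Real.norm_of_nonneg (hc0 k).le]
    exact mul_le_mul_of_nonneg_left (hC _) (hc0 k).le
  have hint : Integrable (fun x => inner ℝ (u x) (H10.grad v x)) (volume.restrict A) :=
    L2.integrable_inner (𝕜 := ℝ) u (H10.grad v)
  have l1 : Tendsto (fun k => ∫ x in A, X k x * inner ℝ (u x) (H10.grad v x)) atTop
      (𝓝 (∫ x in A, inner ℝ (u x) (H10.grad v x))) := by
    refine tendsto_integral_of_dominated_convergence
      (fun x => ‖(inner ℝ (u x) (H10.grad v x) : ℝ)‖)
      (fun k => (hX k).continuous.aestronglyMeasurable.mul hint.1) hint.norm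
      (fun k => ae_of_all _ fun x => ?_) (ae_of_all _ fun x => ?_)
    · rw [norm_mul]; exact mul_le_of_le_one_left (norm_nonneg _) (hX1 k x)
    · simpa using (hXlim x).mul_const (inner ℝ (u x) (H10.grad v x) : ℝ)
  have hvu : Integrable (fun x => ‖H10.fn v x‖ * ‖u x‖) (volume.restrict A) :=
    (Lp.memLp (H10.fn v)).norm.integrable_mul (Lp.memLp u).norm
  have l2 : Tendsto (fun k => ∫ x in A, H10.fn v x * inner ℝ (u x) (gradient (X k) x)) atTop
      (𝓝 0) := by
    have hb : Tendsto (fun k => c k * C * ∫ x in A, ‖H10.fn v x‖ * ‖u x‖) atTop (𝓝 0) := by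
      simpa using (hclim.mul_const C).mul_const (∫ x in A, ‖H10.fn v x‖ * ‖u x‖)
    refine squeeze_zero_norm (fun k => ?_) hb
    rw [← integral_const_mul]
    refine norm_integral_le_of_norm_le (hvu.const_mul _) (ae_of_all _ fun x => ?_)
    rw [norm_mul]
    calc ‖H10.fn v x‖ * ‖(inner ℝ (u x) (gradient (X k) x) : ℝ)‖
        ≤ ‖H10.fn v x‖ * (‖u x‖ * (c k * C)) := by
          gcongr; exact (norm_inner_le_norm _ _).trans (by gcongr; exact hgX k x)
      _ = c k * C * (‖H10.fn v x‖ * ‖u x‖) := by ring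
  have l3 := (l1.add l2).neg
  rw [add_zero] at l3
  have hcong : ∀ k, ∫ x in A, X k x * |f x| = ∫ x in A, X k x * (f x * H10.fn v x) := fun k =>
    integral_congr_ae (by filter_upwards [hfv] with x hx; rw [hx])
  have hres := integrable_and_integral_le_of_tendsto (μ := volume.restrict A)
    (F := fun k x => X k x * |f x|) (f := fun x => |f x|)
    (fun k => by
      have := (hf.integrable_smul_left_of_hasCompactSupport (hX k).continuous (hXc k)).abs
      simpa only [smul_eq_mul, abs_mul, abs_of_nonneg (hX0 k _)] using this)
    (fun k => ae_of_all _ fun x => mul_nonneg (hX0 k x) (abs_nonneg _))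
    (ae_of_all _ fun x => by simpa using (hXlim x).mul_const |f x|)
    (fun k => ((hcong k).trans (h.integral_mul_cutoff hf hv (hX k) (hXc k))).le) l3
  exact ⟨(integrable_norm_iff hf.aestronglyMeasurable).1 hres.1, hres.2⟩

/-- If `div u = f` and `f v = |f|` with `v ∈ H^1_0(A)`, `|v| ≤ 1`, then `v` is extremal in the
definition of `𝒟(u)`. -/
theorem HasDiv.totalDiv_add_integral_eq_zero {u : L2Vec A} {f : Sp N → ℝ} (h : HasDiv A u f)
    (hf : LocallyIntegrable f (volume.restrict A)) {v : H10 A}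
    (hv : ∀ᵐ x ∂(volume.restrict A), |H10.fn v x| ≤ 1)
    (hfv : ∀ᵐ x ∂(volume.restrict A), f x * H10.fn v x = |f x|) :
    totalDiv A u + ((∫ x in A, inner ℝ (u x) (H10.grad v x) : ℝ) : EReal) = 0 := by
  obtain ⟨hi, hle⟩ := h.integrable_and_integral_abs_le hf hv hfv
  -- Chain of inequalities `𝒟(u) ≤ ∫ |f| ≤ -∫ u·∇v ≤ 𝒟(u)`.
  have heq : totalDiv A u = ((-∫ x in A, inner ℝ (u x) (H10.grad v x) : ℝ) : EReal) := by
    refine le_antisymm (iSup₂_le fun φ hφ => ?_) (neg_integral_inner_grad_le_totalDiv u v hv)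
    rw [EReal.coe_le_coe_iff, integral_neg, h φ hφ.1, neg_neg]
    refine le_trans ?_ hle
    refine integral_mono (hi.mul_bdd (c := 1) hφ.1.continuous.aestronglyMeasurable
      (ae_of_all _ hφ.2)) hi.abs fun x => (le_abs_self _).trans ?_
    rw [abs_mul]
    exact mul_le_of_le_one_right (abs_nonneg _) (hφ.2 x)
  rw [heq, ← EReal.coe_add, neg_add_cancel, EReal.coe_zero]

/-! ### Recovering an `H^1_0` function from its gradient. -/

/-- An inequality of Hardy type, in the direction of one coordinate. -/
theorem integral_sq_div_le {φ : Sp N → ℝ} (hφ : IsTest A φ) (i : Fin N) :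
    ∫ x in A, φ x ^ 2 / (1 + x i ^ 2) ≤ Real.pi * ∫ x in A, |φ x| * ‖gradient φ x‖ := by
  have hzero : ∀ x, x ∉ A → φ x = 0 := fun x hx =>
    image_eq_zero_of_notMem_tsupport fun h => hx (hφ.supp h)
  have hcd := hφ.continuous
  have hcg := continuous_gradient hφ.smooth
  have hcf : Continuous (fderiv ℝ φ) := hφ.smooth.continuous_fderiv (by simp)
  let e : Sp N := EuclideanSpace.single i 1
  have he : ‖e‖ = 1 := by simp [e]
  have hi : ∀ x, HasFDerivAt (fun x : Sp N => x i) (EuclideanSpace.proj i : Sp N →L[ℝ] ℝ) x :=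
    fun x => (EuclideanSpace.proj i : Sp N →L[ℝ] ℝ).hasFDerivAt
  have hci : Continuous fun x : Sp N => x i := (EuclideanSpace.proj i : Sp N →L[ℝ] ℝ).continuous
  have hg : ∀ x, HasFDerivAt (fun x : Sp N => Real.arctan (x i))
      ((1 / (1 + x i ^ 2)) • (EuclideanSpace.proj i : Sp N →L[ℝ] ℝ)) x := fun x =>
    (hi x).arctan
  have hf : ∀ x, HasFDerivAt (fun x => φ x * φ x) (φ x • fderiv ℝ φ x + φ x • fderiv ℝ φ x) x :=
    fun x => (hφ.differentiableAt x).hasFDerivAt.mul (hφ.differentiableAt x).hasFDerivAt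
  have hpos : ∀ x : Sp N, 1 + x i ^ 2 ≠ 0 := fun x => by positivity
  have hfe : (fun x => fderiv ℝ (fun x => φ x * φ x) x e * Real.arctan (x i)) =
      fun x => φ x * (2 * fderiv ℝ φ x e * Real.arctan (x i)) := by
    ext x; rw [(hf x).fderiv]; simp; ring
  have hge : (fun x => φ x * φ x * fderiv ℝ (fun x : Sp N => Real.arctan (x i)) x e) =
      fun x => φ x * (φ x / (1 + x i ^ 2)) := by
    ext x; rw [(hg x).fderiv]; simp [e]; ring
  have hc1 : Continuous fun x : Sp N => 2 * fderiv ℝ φ x e * Real.arctan (x i) := by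
    have := Real.continuous_arctan.comp hci
    exact ((hcf.clm_apply continuous_const).const_mul 2).mul this
  have hc2 : Continuous fun x : Sp N => φ x / (1 + x i ^ 2) :=
    hcd.div (by fun_prop) hpos
  have i1 : Integrable fun x => φ x * (2 * fderiv ℝ φ x e * Real.arctan (x i)) :=
    (hcd.mul hc1).integrable_of_hasCompactSupport hφ.compact.mul_right
  have i2 : Integrable fun x => φ x * (φ x / (1 + x i ^ 2)) :=
    (hcd.mul hc2).integrable_of_hasCompactSupport hφ.compact.mul_right
  have i3 : Integrable fun x => φ x * φ x * Real.arctan (x i) :=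
    ((hcd.mul hcd).mul (Real.continuous_arctan.comp hci)).integrable_of_hasCompactSupport
      (hφ.compact.mul_right.mul_right)
  have i4 : Integrable fun x => |φ x| * ‖gradient φ x‖ :=
    (hcd.abs.mul hcg.norm).integrable_of_hasCompactSupport
      ((hφ.compact.comp_left (g := fun y : ℝ => |y|) abs_zero).mul_right)
  -- The weight `1 / (1 + x i ^ 2)` is the derivative of `arctan (x i)`, a function bounded by `π /
  -- 2`. Integrating by parts against `φ²` gives the constant `2 · π / 2`.
  have hparts := integral_mul_fderiv_eq_neg_fderiv_mul_of_integrable (μ := volume)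
    (f := fun x => φ x * φ x) (g := fun x : Sp N => Real.arctan (x i)) (v := e)
    (by rw [hfe]; exact i1) (by rw [hge]; exact i2) i3
    (fun x _ => (hf x).differentiableAt) (fun x _ => (hg x).differentiableAt)
  rw [hge, hfe] at hparts
  rw [setIntegral_eq_integral_of_forall_compl_eq_zero (fun x hx => by simp [hzero x hx]),
    setIntegral_eq_integral_of_forall_compl_eq_zero (fun x hx => by simp [hzero x hx])]
  calc ∫ x, φ x ^ 2 / (1 + x i ^ 2) = ∫ x, φ x * (φ x / (1 + x i ^ 2)) :=
        integral_congr_ae (ae_of_all _ fun x => by ring)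
    _ = ∫ x, -(φ x * (2 * fderiv ℝ φ x e * Real.arctan (x i))) := by
        rw [hparts, integral_neg]
    _ ≤ ∫ x, Real.pi * (|φ x| * ‖gradient φ x‖) := by
        refine integral_mono i1.neg (i4.const_mul _) fun x => (le_abs_self _).trans ?_
        have h1 : |fderiv ℝ φ x e| ≤ ‖gradient φ x‖ := by
          rw [norm_gradient]
          simpa [he] using (fderiv ℝ φ x).le_opNorm e
        have h2 : |Real.arctan (x i)| ≤ Real.pi / 2 :=
          abs_le.2 ⟨(Real.neg_pi_div_two_lt_arctan _).le, (Real.arctan_lt_pi_div_two _).le⟩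
        have hpi := Real.pi_pos
        rw [abs_neg, abs_mul, abs_mul, abs_mul, abs_two]
        calc |φ x| * (2 * |fderiv ℝ φ x e| * |Real.arctan (x i)|)
            ≤ |φ x| * (2 * ‖gradient φ x‖ * (Real.pi / 2)) := by gcongr
          _ = Real.pi * (|φ x| * ‖gradient φ x‖) := by ring
    _ = Real.pi * ∫ x, |φ x| * ‖gradient φ x‖ := integral_const_mul _ _

/-- Along approximating test functions the right side of the Hardy inequality is at most `π ‖ψ n‖
‖∇ψ n‖`, which tends to `0` because the first norm stays bounded. Fatou passes to the weighted
integral of `v²`, whose weight is positive. -/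
theorem H10.fn_eq_zero_of_grad_eq_zero (hN : 1 ≤ N) {v : H10 A} (h : H10.grad v = 0) :
    H10.fn v = 0 := by
  let i : Fin N := ⟨0, hN⟩
  have hmem : v.1 ∈ closure (testGraph A : Set (L2 A × L2Vec A)) := v.2
  obtain ⟨q, hq, hlim⟩ := mem_closure_iff_seq_limit.1 hmem
  have hlim1 : Tendsto (fun n => (q n).1) atTop (𝓝 (H10.fn v)) :=
    (continuous_fst.tendsto _).comp hlim
  obtain ⟨ns, hns, hae⟩ := (tendstoInMeasure_of_tendsto_Lp hlim1).exists_seq_tendsto_ae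
  have hlim2 : Tendsto (fun n => (q (ns n)).2) atTop (𝓝 (H10.grad v)) :=
    ((continuous_snd.tendsto _).comp hlim).comp hns.tendsto_atTop
  have hlim1' := hlim1.comp hns.tendsto_atTop
  choose ψ hψ h1 h2 using fun n => hq (ns n)
  have hbound : ∀ n, ∫ x in A, ψ n x ^ 2 / (1 + x i ^ 2) ≤
      Real.pi * (‖(q (ns n)).1‖ * ‖(q (ns n)).2‖) := by
    intro n
    refine (integral_sq_div_le (hψ n) i).trans (mul_le_mul_of_nonneg_left ?_ Real.pi_pos.le)
    have hm1 := (hψ n).memLp 2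
    have hm2 := (hψ n).memLp_gradient 2
    have e1 : (hm1.toLp : L2 A) = (q (ns n)).1 := Lp.ext (hm1.coeFn_toLp.trans (h1 n).symm)
    have e2 : (hm2.toLp : L2Vec A) = (q (ns n)).2 := Lp.ext (hm2.coeFn_toLp.trans (h2 n).symm)
    have := real_inner_le_norm (hm1.norm.toLp _ : L2 A) (hm2.norm.toLp _ : L2 A)
    rw [L2.inner_def] at this
    have e3 : ∫ x in A, inner ℝ ((hm1.norm.toLp _ : L2 A) x) ((hm2.norm.toLp _ : L2 A) x) =
        ∫ x in A, |ψ n x| * ‖gradient (ψ n) x‖ := by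
      refine integral_congr_ae ?_
      filter_upwards [hm1.norm.coeFn_toLp, hm2.norm.coeFn_toLp] with x hx hx'
      rw [hx, hx']
      simp [mul_comm]
    rw [e3] at this
    refine this.trans (le_of_eq ?_)
    rw [← e1, ← e2]
    simp only [Lp.norm_toLp, eLpNorm_norm]
  have hB : Tendsto (fun n => Real.pi * (‖(q (ns n)).1‖ * ‖(q (ns n)).2‖)) atTop (𝓝 0) := by
    have := ((hlim1'.norm).mul hlim2.norm).const_mul Real.pi
    rw [h] at this
    simpa using this
  have hci : Continuous fun x : Sp N => x i := (EuclideanSpace.proj i : Sp N →L[ℝ] ℝ).continuous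
  have hres := integrable_and_integral_le_of_tendsto (μ := volume.restrict A)
    (F := fun n x => ψ n x ^ 2 / (1 + x i ^ 2)) (f := fun x => H10.fn v x ^ 2 / (1 + x i ^ 2))
    (fun n => by
      have hc : Continuous fun x => (1 + x i ^ 2)⁻¹ * ψ n x :=
        (Continuous.inv₀ (by fun_prop) fun x => by positivity).mul (hψ n).continuous
      have := (hc.mul (hψ n).continuous).integrable_of_hasCompactSupport
        (μ := volume.restrict A) (hψ n).compact.mul_left
      exact this.congr (ae_of_all _ fun x => by simp only [Pi.mul_apply]; ring))
    (fun n => ae_of_all _ fun x => by simp only [Pi.zero_apply]; positivity)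
    (by
      filter_upwards [hae, ae_all_iff.2 h1] with x hx hx1
      exact ((hx.congr hx1).pow 2).div_const _)
    hbound hB
  have h0 : 0 ≤ᵐ[volume.restrict A] fun x => H10.fn v x ^ 2 / (1 + x i ^ 2) :=
    ae_of_all _ fun x => by simp only [Pi.zero_apply]; positivity
  have hz := (integral_eq_zero_iff_of_nonneg_ae h0 hres.1).1
    (le_antisymm hres.2 (integral_nonneg_of_ae h0))
  refine Lp.ext ?_
  filter_upwards [hz, Lp.coeFn_zero ℝ 2 (volume.restrict A)] with x hx hx0
  rw [hx0]
  have : (1 + x i ^ 2 : ℝ) ≠ 0 := by positivity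
  simpa [this] using hx

theorem H10.grad_injective (hN : 1 ≤ N) : Function.Injective (H10.grad (A := A)) := by
  intro v w h
  have hg : H10.grad (v - w) = 0 := sub_eq_zero.2 h
  have hf := H10.fn_eq_zero_of_grad_eq_zero hN hg
  exact sub_eq_zero.1 (Subtype.ext (Prod.ext hf hg))

/-! ### Weak time derivatives and almost-everywhere times. -/

/-- Every smooth function compactly supported in `(0,T)` agrees on `[0,T]` with the derivative of
a smooth function compactly supported in `(-∞,T)`. -/
theorem exists_primitive_compactSupport {T : ℝ} (hT : 0 < T) {θ : ℝ → ℝ} (hθ : ContDiff ℝ ∞ θ)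
    (hθc : HasCompactSupport θ) (hθs : tsupport θ ⊆ Ioo 0 T) :
    ∃ η : ℝ → ℝ, ContDiff ℝ ∞ η ∧ HasCompactSupport η ∧ tsupport η ⊆ Iio T ∧
      ∀ t ∈ Icc 0 T, deriv η t = θ t := by
  -- The gap between `S` and `T` makes the primitive based at `T` vanish on `(S, ∞)`, so its support
  -- stays strictly below `T`.
  obtain ⟨S, hST, hS⟩ : ∃ S < T, tsupport θ ⊆ Iic S := by
    rcases (tsupport θ).eq_empty_or_nonempty with h | h
    · exact ⟨0, hT, by simp [h]⟩
    · obtain ⟨S, hS, hmax⟩ := (show IsCompact (tsupport θ) from hθc).exists_isGreatest h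
      exact ⟨S, (hθs hS).2, fun x hx => hmax hx⟩
  have hθ0 : ∀ r, S < r → θ r = 0 := fun r hr =>
    image_eq_zero_of_notMem_tsupport fun h => (hS h).not_gt hr
  have hder : ∀ s, HasDerivAt (fun s => ∫ r in T..s, θ r) (θ s) s := fun s =>
    intervalIntegral.integral_hasDerivAt_right (hθ.continuous.intervalIntegrable _ _)
      (hθ.continuous.stronglyMeasurableAtFilter _ _) hθ.continuous.continuousAt
  have hderiv : deriv (fun s => ∫ r in T..s, θ r) = θ := funext fun s => (hder s).deriv
  have hΘ : ContDiff ℝ ∞ fun s => ∫ r in T..s, θ r := by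
    rw [contDiff_infty_iff_deriv, hderiv]
    exact ⟨fun s => (hder s).differentiableAt, hθ⟩
  have hΘ0 : ∀ s, S < s → ∫ r in T..s, θ r = 0 := by
    intro s hs
    rw [intervalIntegral.integral_congr (g := fun _ => 0)]
    · simp
    · intro r hr
      refine hθ0 r ?_
      rcases mem_uIcc.1 hr with h | h <;> linarith [h.1]
  -- The primitive may be a nonzero constant at negative times; this cut-off removes it there and
  -- equals `1` near `[0, T]`.
  let κ : ContDiffBump (0 : ℝ) := ⟨T + 1, T + 2, by linarith, by linarith⟩
  refine ⟨fun s => κ s * ∫ r in T..s, θ r, κ.contDiff.mul hΘ, κ.hasCompactSupport.mul_right, ?_, ?_⟩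
  · refine (closure_minimal (fun s hs => ?_) isClosed_Iic).trans (Iic_subset_Iio.2 hST)
    by_contra h
    exact hs (by simp [hΘ0 s (not_le.1 h)])
  · intro t ht
    have hev : (fun s => κ s * ∫ r in T..s, θ r) =ᶠ[𝓝 t] fun s => ∫ r in T..s, θ r := by
      have : t ∈ Metric.ball (0 : ℝ) (T + 1) := by
        rw [mem_ball_zero_iff, Real.norm_eq_abs, abs_of_nonneg ht.1]; linarith [ht.2]
      filter_upwards [Metric.isOpen_ball.mem_nhds this] with s hs
      rw [κ.one_of_mem_closedBall (Metric.ball_subset_closedBall hs), one_mul]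
    rw [hev.deriv_eq, hderiv]

/-- Integration by parts turns the hypothesis into orthogonality of `m - M + ∫ b` to every test
function `θ = η'`. Since `η 0` is not forced to vanish, the initial value `M` is determined and not
merely a constant. -/
theorem ae_eq_sub_integral_of_weak_deriv {T : ℝ} (hT : 0 < T) {m b : ℝ → ℝ} {M : ℝ}
    (hm : IntegrableOn m (Ioo 0 T)) (hb : IntegrableOn b (Ioo 0 T))
    (h : ∀ η : ℝ → ℝ, ContDiff ℝ ∞ η → HasCompactSupport η → tsupport η ⊆ Iio T →
      M * η 0 + (∫ t in Ioo 0 T, m t * deriv η t) - ∫ t in Ioo 0 T, η t * b t = 0) :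
    ∀ᵐ t ∂(volume.restrict (Ioo 0 T)), m t = M - ∫ s in (0 : ℝ)..t, b s := by
  have hbi : IntervalIntegrable b volume 0 T :=
    (intervalIntegrable_iff_integrableOn_Ioo_of_le hT.le).2 hb
  have hac := hbi.absolutelyContinuousOnInterval_intervalIntegral (c := 0) left_mem_uIcc
  have hBc : ContinuousOn (fun t => ∫ s in (0 : ℝ)..t, b s) (Icc 0 T) := by
    simpa [uIcc_of_le hT.le] using hac.continuousOn
  have hBi : IntegrableOn (fun t => ∫ s in (0 : ℝ)..t, b s) (Ioo 0 T) :=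
    (hBc.integrableOn_Icc).mono_set Ioo_subset_Icc_self
  have hdiff : IntegrableOn (fun t => m t - M + ∫ s in (0 : ℝ)..t, b s) (Ioo 0 T) :=
    (hm.sub (integrableOn_const (by simp))).add hBi
  have key := isOpen_Ioo.ae_eq_zero_of_integral_contDiff_smul_eq_zero hdiff.locallyIntegrableOn ?_
  · rw [ae_restrict_iff' measurableSet_Ioo]
    filter_upwards [key] with t ht hmem
    linarith [ht hmem]
  intro θ hθ hθc hθs
  obtain ⟨η, hη, hηc, hηs, hηd⟩ := exists_primitive_compactSupport hT hθ hθc hθs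
  have hηac : AbsolutelyContinuousOnInterval η 0 T :=
    (hη.of_le (by simp)).contDiffOn.absolutelyContinuousOnInterval
  have hηT : η T = 0 := image_eq_zero_of_notMem_tsupport fun h => lt_irrefl T (hηs h)
  have hparts := hηac.integral_mul_deriv_eq_deriv_mul hac
  have hFTC := hηac.integral_deriv_eq_sub
  rw [hηT, intervalIntegral.integral_same] at hparts
  rw [hηT] at hFTC
  have toIoo : ∀ f : ℝ → ℝ, ∫ t in (0 : ℝ)..T, f t = ∫ t in Ioo 0 T, f t := fun f => by
    rw [intervalIntegral.integral_of_le hT.le, integral_Ioc_eq_integral_Ioo]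
  simp only [toIoo] at hparts
  rw [toIoo] at hFTC
  have e1 : ∫ t in Ioo 0 T, η t * deriv (fun t => ∫ s in (0 : ℝ)..t, b s) t =
      ∫ t in Ioo 0 T, η t * b t := by
    refine integral_congr_ae ?_
    filter_upwards [ae_restrict_of_ae hbi.ae_hasDerivAt_integral, ae_restrict_mem measurableSet_Ioo]
      with t ht hmem
    rw [(ht (by rw [uIcc_of_le hT.le]; exact Ioo_subset_Icc_self hmem) 0 left_mem_uIcc).deriv]
  have congrθ : ∀ f : ℝ → ℝ, ∫ t in Ioo 0 T, deriv η t * f t = ∫ t in Ioo 0 T, θ t * f t :=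
    fun f => setIntegral_congr_fun measurableSet_Ioo fun t ht => by
      simp only [hηd t (Ioo_subset_Icc_self ht)]
  have e2 : ∫ t in Ioo 0 T, deriv η t = ∫ t in Ioo 0 T, θ t :=
    setIntegral_congr_fun measurableSet_Ioo fun t ht => hηd t (Ioo_subset_Icc_self ht)
  have e3 : ∫ t in Ioo 0 T, m t * deriv η t = ∫ t in Ioo 0 T, θ t * m t := by
    rw [← congrθ]; simp only [mul_comm]
  obtain ⟨C, hC⟩ := hθ.continuous.bounded_above_of_compact_support hθc
  have hθi : ∀ f : ℝ → ℝ, IntegrableOn f (Ioo 0 T) → IntegrableOn (fun t => θ t * f t) (Ioo 0 T) :=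
    fun f hf => Integrable.bdd_mul (c := C) hf hθ.continuous.aestronglyMeasurable (ae_of_all _ hC)
  have hw := h η hη hηc hηs
  rw [e1, congrθ] at hparts
  rw [e2] at hFTC
  rw [e3] at hw
  rw [← setIntegral_eq_integral_of_forall_compl_eq_zero (s := Ioo 0 T) (fun x hx => by
    rw [image_eq_zero_of_notMem_tsupport fun h => hx (hθs h), zero_smul])]
  have e4 : ∫ t in Ioo 0 T, θ t • (m t - M + ∫ s in (0 : ℝ)..t, b s) =
      ((∫ t in Ioo 0 T, θ t * m t) - ∫ t in Ioo 0 T, θ t * M) +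
        ∫ t in Ioo 0 T, θ t * ∫ s in (0 : ℝ)..t, b s := by
    have hi : IntegrableOn (fun t => θ t * M) (Ioo 0 T) := hθi _ (integrableOn_const (by simp))
    have hi' : IntegrableOn (fun t => θ t * m t - θ t * M) (Ioo 0 T) := (hθi _ hm).sub hi
    rw [← integral_sub (hθi _ hm) hi, ← integral_add hi' (hθi _ hBi)]
    refine integral_congr_ae (ae_of_all _ fun t => ?_)
    simp only [smul_eq_mul]
    ring
  rw [e4, integral_mul_const, hFTC]
  linarith

/-- If for each test function the equation `div U(t) = F(t)` holds at almost every time, then it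
holds at almost every time for all test functions. -/
theorem ae_hasDiv_of_forall_ae {p : ENNReal} (hp : 1 < p) {ν : Measure ℝ} {U : ℝ → L2Vec A}
    {F : ℝ → Sp N → ℝ} (hF : ∀ᵐ t ∂ν, MemLp (F t) p (volume.restrict A))
    (h : ∀ φ : Sp N → ℝ, IsTest A φ → ∀ᵐ t ∂ν,
      ∫ x in A, inner ℝ (U t x) (gradient φ x) = - ∫ x in A, F t x * φ x) :
    ∀ᵐ t ∂ν, HasDiv A (U t) (F t) := by
  have : Fact (1 ≤ p) := ⟨hp.le⟩
  -- The conjugate exponent is finite because `p > 1`, which makes `L^q` separable.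
  obtain ⟨q, hpq, hq1, hqt⟩ : ∃ q, p.HolderConjugate q ∧ 1 ≤ q ∧ q ≠ ⊤ := by
    refine ⟨p.conjExponent, inferInstance, ?_, ?_⟩
    · rw [ENNReal.conjExponent]; exact le_self_add
    · simpa [ENNReal.conjExponent, tsub_eq_zero_iff_le] using hp
  have : Fact (1 ≤ q) := ⟨hq1⟩
  have : Fact (q ≠ ⊤) := ⟨hqt⟩
  have : Fact ((2 : ENNReal) ≠ ⊤) := ⟨by simp⟩
  have : SecondCountableTopology (Lp ℝ q (volume.restrict A)) := inferInstance
  have : SecondCountableTopology (L2Vec A) := inferInstance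
  have : SecondCountableTopology (Lp ℝ q (volume.restrict A) × L2Vec A) := inferInstance
  let P : Set (Lp ℝ q (volume.restrict A) × L2Vec A) :=
    {X | ∃ φ, IsTest A φ ∧ X.1 =ᵐ[volume.restrict A] φ ∧ X.2 =ᵐ[volume.restrict A] gradient φ}
  have hsep : TopologicalSpace.IsSeparable P := TopologicalSpace.IsSeparable.of_separableSpace _
  obtain ⟨D, hDP, hDc, hPD⟩ := hsep.exists_countable_dense_subset
  -- `L` is the defect in `div w = f`, continuous in the pair `(φ, ∇φ)` for `L^q × L²`. It therefore
  -- suffices to exclude null sets of times for a countable dense set of such pairs.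
  let L : ∀ f : Lp ℝ p (volume.restrict A), ∀ w : L2Vec A,
      Lp ℝ q (volume.restrict A) × L2Vec A → ℝ := fun f w X =>
    inner ℝ w X.2 + (ContinuousLinearMap.mul ℝ ℝ).lpPairing (volume.restrict A) p q f X.1
  have hL : ∀ f w, Continuous (L f w) := fun f w => by
    refine (continuous_const.inner continuous_snd).add ?_
    exact (ContinuousLinearMap.continuous _).comp continuous_fst
  have hLeq : ∀ t (hFt : MemLp (F t) p (volume.restrict A)) X φ, X.1 =ᵐ[volume.restrict A] φ →
      X.2 =ᵐ[volume.restrict A] gradient φ → L hFt.toLp (U t) X =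
        (∫ x in A, inner ℝ (U t x) (gradient φ x)) + ∫ x in A, F t x * φ x := by
    intro t hFt X φ h1 h2
    simp only [L]
    rw [L2.inner_def, ContinuousLinearMap.lpPairing_eq_integral]
    congr 1
    · refine integral_congr_ae ?_
      filter_upwards [h2] with x hx
      rw [hx]
    · refine integral_congr_ae ?_
      filter_upwards [h1, hFt.coeFn_toLp] with x hx hx'
      rw [hx, hx', ContinuousLinearMap.mul_apply']
  have hall : ∀ᵐ t ∂ν, ∀ X ∈ D, ∀ hFt : MemLp (F t) p (volume.restrict A),
      L hFt.toLp (U t) X = 0 := by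
    rw [ae_ball_iff hDc]
    intro X hX
    obtain ⟨φ, hφ, h1, h2⟩ := hDP hX
    filter_upwards [h φ hφ] with t ht hFt
    rw [hLeq t hFt X φ h1 h2, ht, neg_add_cancel]
  filter_upwards [hall, hF] with t ht hFt φ hφ
  have hm1 := hφ.memLp q
  have hm2 := hφ.memLp_gradient 2
  have hmem : ((hm1.toLp, hm2.toLp) : Lp ℝ q (volume.restrict A) × L2Vec A) ∈ closure D :=
    hPD ⟨φ, hφ, hm1.coeFn_toLp, hm2.coeFn_toLp⟩
  have hzero : L hFt.toLp (U t) (hm1.toLp, hm2.toLp) = 0 :=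
    (closure_minimal (fun X hX => ht X hX hFt) (isClosed_singleton.preimage (hL _ _))) hmem
  rw [hLeq t hFt _ φ hm1.coeFn_toLp hm2.coeFn_toLp] at hzero
  linarith

/-! ### From the weak Hele-Shaw equation to the divergence flow. -/

/-- The gradient as a continuous linear map on `H^1_0(A)`. -/
noncomputable def H10.gradL (A : Set (Sp N)) : H10 A →L[ℝ] L2Vec A :=
  (ContinuousLinearMap.snd ℝ (L2 A) (L2Vec A)).comp (H10 A).subtypeL

theorem isSpaceTimeTest_mul {T : ℝ} {η : ℝ → ℝ} {ψ : Sp N → ℝ} (hη : ContDiff ℝ ∞ η)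
    (hηc : HasCompactSupport η) (hηs : tsupport η ⊆ Iio T) (hψ : IsTest A ψ) :
    IsSpaceTimeTest A T fun z => η z.1 * ψ z.2 := by
  have hsub : tsupport (fun z : ℝ × Sp N => η z.1 * ψ z.2) ⊆ tsupport η ×ˢ tsupport ψ := by
    refine closure_minimal (fun z hz => ?_) ((isClosed_tsupport η).prod (isClosed_tsupport ψ))
    have := mul_ne_zero_iff.1 hz
    exact ⟨subset_tsupport _ this.1, subset_tsupport _ this.2⟩
  exact ⟨(hη.comp contDiff_fst).mul (hψ.smooth.comp contDiff_snd),
    (hηc.prod hψ.compact).of_isClosed_subset (isClosed_tsupport _) hsub,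
    hsub.trans (prod_mono hηs hψ.supp)⟩

section

variable {T : ℝ} {g : Sp N → ℝ} {Ep Em : Set (ℝ × Sp N)} {v : ℝ → H10 A}

namespace IsWeakHeleShaw

theorem intervalIntegrable (h : IsWeakHeleShaw A T g Ep Em v) {a b : ℝ} (ha : a ∈ Icc 0 T)
    (hb : b ∈ Icc 0 T) : IntervalIntegrable v volume a b := by
  have hi : IntegrableOn v (Icc 0 T) := h.integrable.congr_set_ae Ico_ae_eq_Icc.symm
  exact (hi.mono_set (ordConnected_Icc.uIcc_subset ha hb)).intervalIntegrable

theorem aestronglyMeasurable_indicator (h : IsWeakHeleShaw A T g Ep Em v) :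
    AEStronglyMeasurable ((Ep ∪ Em).indicator fun _ => (1 : ℝ))
      ((volume.restrict (Ioo 0 T)).prod (volume.restrict A)) := by
  have h1 : AEStronglyMeasurable ((Ep ∪ Em).indicator fun _ => (1 : ℝ)) volume :=
    aestronglyMeasurable_const.indicator₀ (h.measurable_pos.union h.measurable_neg)
  rw [Measure.prod_restrict]
  exact h1.restrict

theorem norm_indicator_le (E : Set (ℝ × Sp N)) (z : ℝ × Sp N) :
    ‖E.indicator (fun _ => (1 : ℝ)) z‖ ≤ 1 :=
  (norm_indicator_le_norm_self _ _).trans (by simp)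

theorem ae_memLp (h : IsWeakHeleShaw A T g Ep Em v) {p : ENNReal}
    (hg : MemLp g p (volume.restrict A)) :
    ∀ᵐ t ∂(volume.restrict (Ioo 0 T)),
      MemLp (fun x => g x * (Ep ∪ Em).indicator (fun _ => (1 : ℝ)) (t, x)) p
        (volume.restrict A) := by
  filter_upwards [h.aestronglyMeasurable_indicator.prodMk_left] with t ht
  refine hg.of_le (hg.1.mul ht) (ae_of_all _ fun x => ?_)
  rw [norm_mul]
  exact mul_le_of_le_one_right (norm_nonneg _) (norm_indicator_le _ _)

/-- Separated test functions `η(t) ψ(x)` reduce the weak equation to a scalar one: `∫ g χ_{E(t)} ψ =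
∫ g ψ - ∫_0^t ∫ ∇v·∇ψ` for a.e. `t`. The right side is `-∫ u(t)·∇ψ`, since `div u₀ = g`. -/
theorem ae_hasDiv (h : IsWeakHeleShaw A T g Ep Em v) (hT : 0 < T) {u₀ : L2Vec A} {p : ENNReal}
    (hp : 1 < p) (hg : MemLp g p (volume.restrict A)) (hdiv : HasDiv A u₀ g) {u : ℝ → L2Vec A}
    (hu : ∀ t, u t = u₀ + H10.grad (∫ s in (0 : ℝ)..t, v s)) :
    ∀ᵐ t ∂(volume.restrict (Ioo 0 T)),
      HasDiv A (u t) fun x => g x * (Ep ∪ Em).indicator (fun _ => (1 : ℝ)) (t, x) := by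
  refine ae_hasDiv_of_forall_ae hp (h.ae_memLp hg) fun ψ hψ => ?_
  have hm2 := hψ.memLp_gradient 2
  set Ψ : L2Vec A := hm2.toLp _
  have hΨ : Ψ =ᵐ[volume.restrict A] gradient ψ := hm2.coeFn_toLp
  have hinner : ∀ w : L2Vec A, ∫ x in A, inner ℝ (w x) (gradient ψ x) = inner ℝ Ψ w := fun w => by
    rw [real_inner_comm, L2.inner_def]
    refine integral_congr_ae ?_
    filter_upwards [hΨ] with x hx
    rw [hx]
  -- Writing `∫ ∇w·∇ψ` as a continuous functional of `w` lets it commute with the Bochner integral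
  -- of `v`.
  let ℓ : H10 A →L[ℝ] ℝ := (innerSL ℝ Ψ).comp (H10.gradL A)
  have hℓ' : ∀ w, ℓ w = inner ℝ Ψ (H10.grad w) := fun _ => rfl
  have hℓ : ∀ w, ℓ w = ∫ x in A, inner ℝ (H10.grad w x) (gradient ψ x) := fun w =>
    (hinner _).symm
  have hgψ : Integrable (fun x => g x * ψ x) (volume.restrict A) := by
    have := (hg.locallyIntegrable hp.le).integrable_smul_right_of_hasCompactSupport
      hψ.continuous hψ.compact
    simpa [mul_comm] using this
  have hbint : IntegrableOn (fun t => ℓ (v t)) (Ioo 0 T) :=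
    ℓ.integrable_comp (h.integrable.mono_set Ioo_subset_Ico_self)
  have hmint : IntegrableOn (fun t => ∫ x in A, g x * (Ep ∪ Em).indicator (fun _ => (1 : ℝ)) (t, x)
      * ψ x) (Ioo 0 T) := by
    have hprod : Integrable (fun z : ℝ × Sp N => g z.2 * (Ep ∪ Em).indicator (fun _ => (1 : ℝ)) z *
        ψ z.2) ((volume.restrict (Ioo 0 T)).prod (volume.restrict A)) := by
      have h1 : Integrable (fun z : ℝ × Sp N => g z.2 * ψ z.2)
          ((volume.restrict (Ioo 0 T)).prod (volume.restrict A)) := hgψ.comp_snd _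
      exact (h1.bdd_mul (c := 1) h.aestronglyMeasurable_indicator
        (ae_of_all _ (norm_indicator_le _))).congr (ae_of_all _ fun z => by ring)
    exact hprod.integral_prod_left
  have hweak := ae_eq_sub_integral_of_weak_deriv hT (M := ∫ x in A, g x * ψ x) hmint hbint ?_
  · filter_upwards [hweak, ae_restrict_mem measurableSet_Ioo] with t ht hmem
    have hvi : IntervalIntegrable v volume 0 t :=
      h.intervalIntegrable ⟨le_rfl, hT.le⟩ (Ioo_subset_Icc_self hmem)
    have hcomm : ∫ s in (0 : ℝ)..t, ℓ (v s) = ℓ (∫ s in (0 : ℝ)..t, v s) :=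
      ℓ.intervalIntegral_comp_comm hvi
    rw [ht, hcomm, hℓ', hinner (u t), hu t, inner_add_right, ← hinner u₀, hdiv ψ hψ]
    ring
  · intro η hη hηc hηs
    have hw := h.weak _ (isSpaceTimeTest_mul hη hηc hηs hψ)
    have hηψ : ∀ t x, gradient (fun y => η t * ψ y) x = η t • gradient ψ x := fun t x => by
      have := gradient_comp (τ := fun s => η t * s) (x := x)
        (differentiableAt_id.const_mul (η t)) (hψ.differentiableAt x)
      rw [this]
      simp
    have hdη : ∀ t x, deriv (fun s => η s * ψ x) t = deriv η t * ψ x := fun t x => by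
      rw [deriv_mul_const (hη.differentiable (by simp) t)]
    simp only [hηψ, hdη, inner_smul_right, integral_const_mul] at hw
    refine Eq.trans ?_ hw
    congr 1
    congr 1
    · rw [← integral_mul_const]
      exact integral_congr_ae (ae_of_all _ fun x => by ring)
    · refine integral_congr_ae (ae_of_all _ fun t => ?_)
      simp only
      rw [← integral_mul_const]
      exact integral_congr_ae (ae_of_all _ fun x => by ring)
    · exact integral_congr_ae (ae_of_all _ fun t => by simp only [hℓ])

end IsWeakHeleShaw

end

variable {T : ℝ}

section

variable {g : Sp N → ℝ} {Ep Em : Set (ℝ × Sp N)} {v : ℝ → H10 A} {u₀ : L2Vec A} {u : ℝ → L2Vec A}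

theorem IsWeakHeleShaw.ae_mul_fn_eq_abs (h : IsWeakHeleShaw A T g Ep Em v)
    (hsign : SignCondition A T g Ep Em) :
    ∀ᵐ t ∂(volume.restrict (Ioo 0 T)), ∀ᵐ x ∂(volume.restrict A),
      g x * (Ep ∪ Em).indicator (fun _ => (1 : ℝ)) (t, x) * H10.fn (v t) x =
        |g x * (Ep ∪ Em).indicator (fun _ => (1 : ℝ)) (t, x)| := by
  filter_upwards [h.eq_pos, h.eq_neg, hsign] with t h1 h2 h3
  filter_upwards [h1, h2, h3] with x k1 k2 k3
  by_cases hp : (t, x) ∈ Ep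
  · simp [hp, k1 hp, abs_of_nonneg (k3.1 hp)]
  by_cases hm : (t, x) ∈ Em
  · simp [hm, k2 hm, abs_of_nonpos (k3.2 hm)]
  · simp [hp, hm]

theorem map_integral_sub_map_integral {X Y : Type*} [NormedAddCommGroup X] [NormedSpace ℝ X]
    [CompleteSpace X] [NormedAddCommGroup Y] [NormedSpace ℝ Y] [CompleteSpace Y] (L : X →L[ℝ] Y)
    {f : ℝ → X} {a s t : ℝ} (hs : IntervalIntegrable f volume a s)
    (ht : IntervalIntegrable f volume a t) :
    L (∫ r in a..t, f r) - L (∫ r in a..s, f r) = ∫ r in s..t, L (f r) := by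
  rw [L.intervalIntegral_comp_comm (hs.symm.trans ht), ← map_sub,
    intervalIntegral.integral_interval_sub_left ht hs]

/-- A weak Hele-Shaw solution with the sign condition induces a solution of the divergence flow. -/
theorem IsWeakHeleShaw.isDivFlow (h : IsWeakHeleShaw A T g Ep Em v) (hT : 0 < T)
    (hsign : SignCondition A T g Ep Em) {p : ENNReal} (hp : 1 < p)
    (hg : MemLp g p (volume.restrict A)) (hdiv : HasDiv A u₀ g)
    (hu : ∀ t, u t = u₀ + H10.grad (∫ s in (0 : ℝ)..t, v s)) : IsDivFlow A T u₀ u v := by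
  have hu' : ∀ t, u t = u₀ + H10.gradL A (∫ s in (0 : ℝ)..t, v s) := hu
  refine ⟨?_, ?_, ?_, h.bound, ?_⟩
  · have hi : IntegrableOn v (uIcc 0 T) := by
      rw [uIcc_of_le hT.le]; exact h.integrable.congr_set_ae Ico_ae_eq_Icc.symm
    have hc : ContinuousOn (fun t => ∫ s in (0 : ℝ)..t, v s) (Ico 0 T) := by
      refine (intervalIntegral.continuousOn_primitive_interval hi).mono ?_
      rw [uIcc_of_le hT.le]; exact Ico_subset_Icc_self
    exact (continuousOn_const.add ((H10.gradL A).continuous.comp_continuousOn hc)).congr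
      fun t _ => hu' t
  · rw [hu', intervalIntegral.integral_same, map_zero, add_zero]
  · intro s t hs hst ht
    have hmem0 : (0 : ℝ) ∈ Icc 0 T := ⟨le_rfl, hT.le⟩
    have hmems : s ∈ Icc 0 T := ⟨hs.le, (hst.trans ht).le⟩
    have hmemt : t ∈ Icc 0 T := ⟨(hs.trans hst).le, ht.le⟩
    have hi := h.intervalIntegrable hmems hmemt
    refine ⟨⟨(H10.gradL A).integrable_comp hi.1, (H10.gradL A).integrable_comp hi.2⟩, ?_⟩
    rw [hu', hu', add_sub_add_left_eq_sub]
    exact map_integral_sub_map_integral (H10.gradL A) (h.intervalIntegrable hmem0 hmems)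
      (h.intervalIntegrable hmem0 hmemt)
  · filter_upwards [h.ae_hasDiv hT hp hg hdiv hu, h.bound, h.ae_mul_fn_eq_abs hsign, h.ae_memLp hg]
      with t h1 h2 h3 h4
    exact h1.totalDiv_add_integral_eq_zero (h4.locallyIntegrable hp.le) h2 h3

/-! ### Uniqueness of the divergence, of the pressure and of the sets. -/

theorem HasDiv.ae_eq (hA : IsOpen A) {w : L2Vec A} {f₁ f₂ : Sp N → ℝ}
    (h₁ : HasDiv A w f₁) (h₂ : HasDiv A w f₂) (hf₁ : LocallyIntegrable f₁ (volume.restrict A))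
    (hf₂ : LocallyIntegrable f₂ (volume.restrict A)) : f₁ =ᵐ[volume.restrict A] f₂ := by
  have hd : LocallyIntegrable (fun x => f₁ x - f₂ x) (volume.restrict A) := hf₁.sub hf₂
  have key := hA.ae_eq_zero_of_integral_contDiff_smul_eq_zero (μ := volume)
    (f := fun x => f₁ x - f₂ x) (locallyIntegrableOn_of_locallyIntegrable_restrict hd) ?_
  · filter_upwards [(ae_restrict_iff' hA.measurableSet).2 key] with x hx
    exact sub_eq_zero.1 hx
  · intro φ hφ hφc hφs
    have e₁ := h₁ φ ⟨hφ, hφc, hφs⟩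
    have e₂ := h₂ φ ⟨hφ, hφc, hφs⟩
    have i₁ := hf₁.integrable_smul_left_of_hasCompactSupport hφ.continuous hφc
    have i₂ := hf₂.integrable_smul_left_of_hasCompactSupport hφ.continuous hφc
    rw [← setIntegral_eq_integral_of_forall_compl_eq_zero (s := A) (fun x hx => by
      rw [image_eq_zero_of_notMem_tsupport fun h => hx (hφs h), zero_smul])]
    simp only [smul_sub]
    rw [integral_sub i₁ i₂]
    simp only [smul_eq_mul, mul_comm (φ _)]
    linarith

end

/-- Lebesgue differentiation on each interval with rational endpoints; countably many of these cover
`(0, T)`, and no integrability up to the endpoints is needed. -/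
theorem ae_eq_zero_of_intervalIntegral_eq_zero {H : Type*} [NormedAddCommGroup H]
    [NormedSpace ℝ H] [CompleteSpace H] {w : ℝ → H}
    (h : ∀ s t, 0 < s → s < t → t < T → IntervalIntegrable w volume s t ∧ ∫ r in s..t, w r = 0) :
    ∀ᵐ t ∂(volume.restrict (Ioo 0 T)), w t = 0 := by
  have hab : ∀ a b : ℚ, (0 : ℝ) < a → (a : ℝ) < b → (b : ℝ) < T →
      ∀ᵐ t, t ∈ Ioo (a : ℝ) b → w t = 0 := by
    intro a b ha hab hb
    have hi := (h a b ha hab hb).1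
    filter_upwards [hi.ae_hasDerivAt_integral] with t ht hmem
    have h1 := ht (by rw [uIcc_of_le hab.le]; exact Ioo_subset_Icc_self hmem) a left_mem_uIcc
    have h2 : (fun x => ∫ r in (a : ℝ)..x, w r) =ᶠ[𝓝 t] fun _ => 0 := by
      filter_upwards [isOpen_Ioo.mem_nhds hmem] with x hx
      exact (h a x ha hx.1 (hx.2.trans hb)).2
    exact h1.unique ((hasDerivAt_const t 0).congr_of_eventuallyEq h2)
  rw [ae_restrict_iff' measurableSet_Ioo]
  have hall : ∀ᵐ t, ∀ a b : ℚ, (0 : ℝ) < a → (a : ℝ) < b → (b : ℝ) < T →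
      t ∈ Ioo (a : ℝ) b → w t = 0 := by
    simp only [ae_all_iff]
    exact hab
  filter_upwards [hall] with t ht hmem
  obtain ⟨a, ha0, hat⟩ := exists_rat_btwn hmem.1
  obtain ⟨b, htb, hbT⟩ := exists_rat_btwn hmem.2
  exact ht a b ha0 (hat.trans htb) hbT ⟨hat, htb⟩

/-- Both curves are gradient flows, hence equal; their velocities `∇v₁` and `∇v₂` then agree almost
everywhere, and the gradient is injective on `H^1_0`. -/
theorem IsDivFlow.eqOn_and_ae_eq (hN : 1 ≤ N) {u₀ : L2Vec A} {u₁ u₂ : ℝ → L2Vec A}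
    {v₁ v₂ : ℝ → H10 A} (h₁ : IsDivFlow A T u₀ u₁ v₁) (h₂ : IsDivFlow A T u₀ u₂ v₂) :
    EqOn u₁ u₂ (Ico 0 T) ∧ v₁ =ᵐ[volume.restrict (Ioo 0 T)] v₂ := by
  have heq := h₁.isGradientFlow.eqOn h₂.isGradientFlow
  refine ⟨heq, ?_⟩
  have := ae_eq_zero_of_intervalIntegral_eq_zero (T := T)
    (w := fun t => H10.grad (v₁ t) - H10.grad (v₂ t)) fun s t hs hst ht => by
      obtain ⟨i₁, e₁⟩ := h₁.evol s t hs hst ht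
      obtain ⟨i₂, e₂⟩ := h₂.evol s t hs hst ht
      refine ⟨i₁.sub i₂, ?_⟩
      rw [intervalIntegral.integral_sub i₁ i₂, ← e₁, ← e₂, heq ⟨hs.le, hst.trans ht⟩,
        heq ⟨(hs.trans hst).le, ht⟩, sub_self]
  filter_upwards [this] with t ht
  exact H10.grad_injective hN (sub_eq_zero.1 ht)

end HeleShaw

theorem mainTheorem2 {N : ℕ} (hN : 1 ≤ N) (A : Set (HeleShaw.Sp N)) (hA : IsOpen A)
    (T : ℝ) (hT : 0 < T)
    (u₀ : HeleShaw.L2Vec A) (g : HeleShaw.Sp N → ℝ)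
    (p : ENNReal) (hp : 1 < p) (hg : MemLp g p (volume.restrict A))
    (hdiv : HeleShaw.HasDiv A u₀ g)
    (Ep Em : Set (ℝ × HeleShaw.Sp N)) (v : ℝ → HeleShaw.H10 A)
    (hweak : HeleShaw.IsWeakHeleShaw A T g Ep Em v)
    (hsign : HeleShaw.SignCondition A T g Ep Em)
    (hEp : HeleShaw.Nonincreasing A T Ep) (hEm : HeleShaw.Nonincreasing A T Em)
    (u : ℝ → HeleShaw.L2Vec A)
    (hu : ∀ t, u t = u₀ + HeleShaw.H10.grad (∫ s in (0 : ℝ)..t, v s)) :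
    -- `u`, with the given `v`, solves the flow, and it is the only solution
    HeleShaw.IsDivFlow A T u₀ u v ∧
    (∀ (u₁ : ℝ → HeleShaw.L2Vec A) (v₁ : ℝ → HeleShaw.H10 A),
      HeleShaw.IsDivFlow A T u₀ u₁ v₁ →
        EqOn u₁ u (Ico 0 T) ∧ v₁ =ᵐ[volume.restrict (Ioo 0 T)] v) ∧
    HeleShaw.IsGradientFlow A T u₀ u ∧
    (∀ u₁ : ℝ → HeleShaw.L2Vec A,
      HeleShaw.IsGradientFlow A T u₀ u₁ → EqOn u₁ u (Ico 0 T)) ∧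
    -- uniqueness of the weak Hele-Shaw solution
    (∀ (Ep₁ Em₁ : Set (ℝ × HeleShaw.Sp N)) (v₁ : ℝ → HeleShaw.H10 A),
      HeleShaw.IsWeakHeleShaw A T g Ep₁ Em₁ v₁ →
      HeleShaw.SignCondition A T g Ep₁ Em₁ →
      HeleShaw.Nonincreasing A T Ep₁ → HeleShaw.Nonincreasing A T Em₁ →
        v₁ =ᵐ[volume.restrict (Ioo 0 T)] v ∧
        ∀ᵐ t ∂(volume.restrict (Ioo 0 T)), ∀ᵐ x ∂(volume.restrict A),
          g x ≠ 0 → (((t, x) ∈ Ep₁ ↔ (t, x) ∈ Ep) ∧ ((t, x) ∈ Em₁ ↔ (t, x) ∈ Em))) := by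
  have hflow := hweak.isDivFlow hT hsign hp hg hdiv hu
  refine ⟨hflow, fun u₁ v₁ h₁ => h₁.eqOn_and_ae_eq hN hflow, hflow.isGradientFlow,
    fun u₁ h₁ => h₁.eqOn hflow.isGradientFlow, fun Ep₁ Em₁ v₁ hweak₁ hsign₁ _ _ => ?_⟩
  obtain ⟨hueq, hveq⟩ :=
    (hweak₁.isDivFlow hT hsign₁ hp hg hdiv fun _ => rfl).eqOn_and_ae_eq hN hflow
  refine ⟨hveq, ?_⟩
  filter_upwards [hweak.ae_hasDiv hT hp hg hdiv hu,
    hweak₁.ae_hasDiv hT hp hg hdiv fun _ => rfl, hweak.ae_memLp hg, hweak₁.ae_memLp hg, hsign,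
    hsign₁, ae_restrict_mem measurableSet_Ioo] with t d d₁ m m₁ s s₁ ht
  have hut := hueq (Ioo_subset_Ico_self ht)
  simp only at hut
  rw [hut] at d₁
  -- Both `g χ_{E₁(t)}` and `g χ_{E(t)}` are the divergence of the same field, so they agree;
  -- dividing by `g ≠ 0` identifies the unions.
  filter_upwards [d₁.ae_eq hA d (m₁.locallyIntegrable hp.le) (m.locallyIntegrable hp.le), s, s₁]
    with x hx hs hs₁ hgx
  have hiff : (t, x) ∈ Ep₁ ∪ Em₁ ↔ (t, x) ∈ Ep ∪ Em := by
    have h1 := mul_left_cancel₀ hgx hx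
    refine ⟨fun k₁ => by_contra fun k => ?_, fun k => by_contra fun k₁ => ?_⟩
    · rw [indicator_of_mem k₁, indicator_of_notMem k] at h1
      exact one_ne_zero h1
    · rw [indicator_of_mem k, indicator_of_notMem k₁] at h1
      exact zero_ne_one h1
  simp only [mem_union] at hiff
  -- The sign condition leaves only the negative set where `g < 0` and only the positive set where
  -- `g > 0`.
  rcases lt_or_gt_of_ne hgx with hneg | hpos
  · have a : (t, x) ∉ Ep := fun h => (hs.1 h).not_gt hneg
    have a₁ : (t, x) ∉ Ep₁ := fun h => (hs₁.1 h).not_gt hneg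
    exact ⟨⟨fun h => absurd h a₁, fun h => absurd h a⟩,
      ⟨fun h => (hiff.1 (.inr h)).resolve_left a, fun h => (hiff.2 (.inr h)).resolve_left a₁⟩⟩
  · have a : (t, x) ∉ Em := fun h => (hs.2 h).not_gt hpos
    have a₁ : (t, x) ∉ Em₁ := fun h => (hs₁.2 h).not_gt hpos
    exact ⟨⟨fun h => (hiff.1 (.inl h)).resolve_right a, fun h => (hiff.2 (.inl h)).resolve_right a₁⟩,
      ⟨fun h => absurd h a₁, fun h => absurd h a⟩⟩
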